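/- Let $k$ be a field with $\operatorname{char}(k)\neq 2$. Let $V=k^6$ with basis $e_1,\dots,e_6$ and with the alternating form $Q$ determined by $Q(e_i,e_{i+3})=1$ for $i=1,2,3$ and $Q(e_i,e_j)=0$ for all other $i<j$; let $Sp_6(k)$ be the symplectic group of $Q$. Let $X_k=\ker(\phi)\subset\wedge^3V$ be the $14$-dimensional kernel of the contraction $\phi:\wedge^3V\to V$, $$\phi(v_1\wedge v_2\wedge v_3)=Q(v_2,v_3)v_1-Q(v_1,v_3)v_2+Q(v_1,v_2)v_3 .$$ Write $x_{ijl}$ for the coordinates of $x\in X_k$ with respect to the elements $e_ie_je_l:=e_i\wedge e_j\wedge e_l$ (alternating in the indices). Put $x_0=-x_{123}$ and $y_0=-x_{456}$, and let $A=(a_{ij})$ and $B=(b_{ij})$ be the symmetric $3\times 3$ matrices such that $a_{ij}$ is the coordinate whose index triple is $123$ with the $j$-th index replaced by $i+3$, and $b_{ij}$ is the coordinate whose index triple is $456$ with the $j$-th index replaced by $i$. Let $J$ be the $Sp_6$-invariant quartic form $$J(x)=x_0\det B+y_0\det A+\operatorname{tr}(A^{\#}B^{\#})-\tfrac14\bigl(x_0y_0-\operatorname{tr}(AB)\bigr)^2$$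 on $X_k$, where $\#$ denotes the adjugate. The group $(Sp_6\times GL_1)(k)=Sp_6(k)\times k^\times$ acts on $X_k$, with $k^\times$ acting by scalar multiplication. A composition algebra over $k$ is a nonzero unital, not necessarily associative $k$-algebra with a nondegenerate quadratic form $N_C$ (the norm) satisfying $N_C(xy)=N_C(x)N_C(y)$; isomorphisms are isomorphisms of the underlying algebras. **Theorem.** 1. For every nonzero $x\in X_k$ with $J(x)=0$, the $(Sp_6\times GL_1)(k)$-orbit of $x$ equals its $Sp_6(k)$-orbit. 2. The composition algebras over $k$ of dimension at most $4$ have dimension $1$, $2$ or $4$, and the nonzero $(Sp_6\times GL_1)(k)$-orbits in $J^{-1}(0)(k)$ are in bijection with the isomorphism classes of these algebras. 3. For all $a,b,c\in k^\times$ the vectors $$-e_1e_2e_3,\qquad -e_1e_2e_3+a\,e_1e_5e_6,\qquad a\,e_4e_2e_3+b\,e_1e_5e_3+c\,e_1e_2e_6$$ are nonzero elements of $J^{-1}(0)(k)$, and every nonzero orbit in $J^{-1}(0)(k)$ contains a vector of one of these forms. The bijection in 2 can be chosen such that, for all $a,b,c\in k^\times$, these vectors lie in the orbit corresponding to the class of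 $C$ if and only if $N_C$ is isometric to $\langle 1\rangle$, to $\langle 1,-a\rangle$, and to $\langle 1,bc,ac,ab\rangle$, respectively. -/

import Mathlib

/-! ### The 14-dimensional representation of `Sp₆` and its quartic invariant -/

noncomputable section

namespace SixSymplectic

universe u

/-- The six-dimensional space `V`.  The basis vector `e_i` (`i = 1, 2, 3`) is indexed by
`Sum.inl (i - 1)` and `e_{i+3}` by `Sum.inr (i - 1)`. -/
abbrev V (k : Type u) : Type u := Fin 3 ⊕ Fin 3 → k

/-- The symplectic group `Sp₆(k)`: the `6 × 6` matrices `g` with `g M gᵗ = M`, where `M` is the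
Gram matrix of the standard alternating form. -/
abbrev Sp6 (k : Type u) [Field k] : Submonoid (Matrix (Fin 3 ⊕ Fin 3) (Fin 3 ⊕ Fin 3) k) :=
  Matrix.symplecticGroup (Fin 3) k

/-- The third exterior power `⋀³ V`. -/
abbrev Wedge3 (k : Type u) [Field k] : Type u := ↥(⋀[k]^3 (V k))

/-- The action of a matrix on `⋀³ V` induced by its action `v ↦ g v` on `V`. -/
def act {k : Type u} [Field k] (g : Matrix (Fin 3 ⊕ Fin 3) (Fin 3 ⊕ Fin 3) k) :
    Wedge3 k →ₗ[k] Wedge3 k :=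
  exteriorPower.map 3 (Matrix.toLin' g)

/-- The standard alternating form on `V`, with Gram matrix `(0, I₃; -I₃, 0)`. -/
def Q {k : Type u} [Field k] (v w : V k) : k :=
  ∑ i : Fin 3, (v (Sum.inl i) * w (Sum.inr i) - v (Sum.inr i) * w (Sum.inl i))

/-- The alternating trilinear map
`(v₁, v₂, v₃) ↦ Q(v₂, v₃) v₁ - Q(v₁, v₃) v₂ + Q(v₁, v₂) v₃`. -/
def contractionAlt (k : Type u) [Field k] : V k [⋀^Fin 3]→ₗ[k] V k where
  toFun v := Q (v 1) (v 2) • v 0 - Q (v 0) (v 2) • v 1 + Q (v 0) (v 1) • v 2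
  map_update_add' := by
    intro inst m i x y
    obtain rfl : inst = instDecidableEqFin 3 := Subsingleton.elim _ _
    ext t
    fin_cases i <;>
      simp [Q, Fin.sum_univ_three, Function.update] <;> ring
  map_update_smul' := by
    intro inst m i c x
    obtain rfl : inst = instDecidableEqFin 3 := Subsingleton.elim _ _
    ext t
    fin_cases i <;>
      simp [Q, Fin.sum_univ_three, Function.update] <;> ring
  map_eq_zero_of_eq' := by
    intro v i j h hij
    ext t
    fin_cases i <;> fin_cases j <;> simp_all [Q, Fin.sum_univ_three] <;> ring_nf <;>
      simp

/-- The contraction `φ : ⋀³ V → V`. -/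
def contraction (k : Type u) [Field k] : Wedge3 k →ₗ[k] V k :=
  exteriorPower.alternatingMapLinearEquiv (contractionAlt k)

/-- The representation `X = ⋀³₀ V = ker φ` (its `k`-rational points), of dimension `14`. -/
def X (k : Type u) [Field k] : Submodule k (Wedge3 k) :=
  LinearMap.ker (contraction k)

/-- The coordinate `x_{s₀ s₁ s₂}` of `x ∈ ⋀³ V` with respect to the standard basis of `V`,
alternating in its three indices: it sends `v₁ ∧ v₂ ∧ v₃` to `det (vₐ(s_b))`. -/
def coord {k : Type u} [Field k] (s : Fin 3 → Fin 3 ⊕ Fin 3) : Wedge3 k →ₗ[k] k :=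
  exteriorPower.alternatingMapLinearEquiv
    ((Matrix.detRowAlternating (R := k) (n := Fin 3)).compLinearMap (LinearMap.funLeft k k s))

/-- `x₀ = -x₁₂₃`. -/
def x0 {k : Type u} [Field k] (x : Wedge3 k) : k := -coord Sum.inl x

/-- `y₀ = -x₄₅₆`. -/
def y0 {k : Type u} [Field k] (x : Wedge3 k) : k := -coord Sum.inr x

/-- The matrix `A`, whose entry `a_{ij}` is the coordinate whose index triple is `123` with the
`j`-th index replaced by `i + 3`; for instance `a₁₁ = x₄₂₃` and `a₁₂ = x₁₄₃`. -/
def matA {k : Type u} [Field k] (x : Wedge3 k) : Matrix (Fin 3) (Fin 3) k :=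
  Matrix.of fun i j => coord (Function.update Sum.inl j (Sum.inr i)) x

/-- The matrix `B`, whose entry `b_{ij}` is the coordinate whose index triple is `456` with the
`j`-th index replaced by `i`; for instance `b₁₁ = x₁₅₆` and `b₁₂ = x₄₁₆`. -/
def matB {k : Type u} [Field k] (x : Wedge3 k) : Matrix (Fin 3) (Fin 3) k :=
  Matrix.of fun i j => coord (Function.update Sum.inr j (Sum.inl i)) x

/-- The quartic `J(x) = x₀ det B + y₀ det A + tr(A^# B^#) - (1/4)(x₀ y₀ - tr(A B))²`, used for
`x ∈ X`; here `#` is the adjugate. -/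
def quarticJ {k : Type u} [Field k] (x : Wedge3 k) : k :=
  x0 x * (matB x).det + y0 x * (matA x).det + ((matA x).adjugate * (matB x).adjugate).trace
    - (1 / 4) * (x0 x * y0 x - (matA x * matB x).trace) ^ 2

/-- The nonzero part `J⁻¹(0)(k) - {0}` of the null cone in `X`. -/
def nonzeroNullCone (k : Type u) [Field k] : Set (Wedge3 k) :=
  {x | x ∈ X k ∧ quarticJ x = 0 ∧ x ≠ 0}

/-- The `Sp₆(k)`-orbit of `x`. -/
def spOrbit {k : Type u} [Field k] (x : Wedge3 k) : Set (Wedge3 k) :=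
  {y | ∃ g : Sp6 k, y = act g.1 x}

/-- The `(Sp₆ × GL₁)(k)`-orbit of `x`, where `GL₁` acts by scalar multiplication. -/
def spGLOrbit {k : Type u} [Field k] (x : Wedge3 k) : Set (Wedge3 k) :=
  {y | ∃ p : Sp6 k × kˣ, y = (p.2 : k) • act p.1.1 x}

/-- The set of nonzero `(Sp₆ × GL₁)(k)`-orbits in the null cone. -/
def nullOrbits (k : Type u) [Field k] : Set (Set (Wedge3 k)) :=
  {O | ∃ x ∈ nonzeroNullCone k, O = spGLOrbit x}

/-- The basis vector `e_i` of `V`. -/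
def e {k : Type u} [Field k] (i : Fin 3 ⊕ Fin 3) : V k := Pi.single i 1

/-- `u ∧ v ∧ w ∈ ⋀³ V`. -/
def wedge {k : Type u} [Field k] (u v w : V k) : Wedge3 k :=
  exteriorPower.ιMulti k 3 ![u, v, w]

/-- The vector `-e₁ ∧ e₂ ∧ e₃`. -/
def rep1 (k : Type u) [Field k] : Wedge3 k :=
  -wedge (e (.inl 0)) (e (.inl 1)) (e (.inl 2))

/-- The vector `-e₁ ∧ e₂ ∧ e₃ + a e₁ ∧ e₅ ∧ e₆`. -/
def rep2 {k : Type u} [Field k] (a : k) : Wedge3 k :=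
  -wedge (e (.inl 0)) (e (.inl 1)) (e (.inl 2))
    + a • wedge (e (.inl 0)) (e (.inr 1)) (e (.inr 2))

/-- The vector `a e₄ ∧ e₂ ∧ e₃ + b e₁ ∧ e₅ ∧ e₃ + c e₁ ∧ e₂ ∧ e₆`. -/
def rep4 {k : Type u} [Field k] (a b c : k) : Wedge3 k :=
  a • wedge (e (.inr 0)) (e (.inl 1)) (e (.inl 2))
    + b • wedge (e (.inl 0)) (e (.inr 1)) (e (.inl 2))
    + c • wedge (e (.inl 0)) (e (.inl 1)) (e (.inr 2))

/-! ### Composition algebras -/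

/-- A composition algebra over `k`: a nonzero unital, not necessarily associative `k`-algebra
with a nondegenerate multiplicative quadratic form. -/
structure CompositionAlgebra (k : Type u) [Field k] where
  carrier : Type u
  [ring : NonAssocRing carrier]
  [module : Module k carrier]
  [scalarTower : IsScalarTower k carrier carrier]
  [smulComm : SMulCommClass k carrier carrier]
  [nontrivial : Nontrivial carrier]
  norm : QuadraticForm k carrier
  nondegenerate : norm.polarBilin.Nondegenerate
  norm_mul : ∀ x y : carrier, norm (x * y) = norm x * norm y

attribute [instance] CompositionAlgebra.ring CompositionAlgebra.module
  CompositionAlgebra.scalarTower CompositionAlgebra.smulComm CompositionAlgebra.nontrivial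

/-- Composition algebras are isomorphic if the underlying algebras are. -/
def CompositionAlgebra.Iso {k : Type u} [Field k] (C D : CompositionAlgebra k) : Prop :=
  ∃ f : C.carrier ≃ₗ[k] D.carrier, ∀ x y : C.carrier, f (x * y) = f x * f y

/-- Composition algebras of dimension at most `4`. -/
def SmallCompositionAlgebra (k : Type u) [Field k] : Type (u + 1) :=
  {C : CompositionAlgebra k // Module.rank k C.carrier ≤ 4}

/-- Isomorphism as an equivalence relation on composition algebras of dimension at most `4`. -/
def isoSetoid (k : Type u) [Field k] : Setoid (SmallCompositionAlgebra k) where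
  r C D := C.1.Iso D.1
  iseqv :=
    { refl := fun _ => ⟨LinearEquiv.refl k _, fun _ _ => rfl⟩
      symm := by
        rintro C D ⟨f, hf⟩
        exact ⟨f.symm, fun x y => f.injective (by simp [hf])⟩
      trans := by
        rintro C D E ⟨f, hf⟩ ⟨g, hg⟩
        exact ⟨f.trans g, fun x y => by simp [hf, hg]⟩ }

/-- The set of isomorphism classes of composition algebras of dimension at most `4`. -/
def SmallClasses (k : Type u) [Field k] : Type (u + 1) := Quotient (isoSetoid k)

/-- The isomorphism class of a composition algebra of dimension at most `4`. -/
def isoClass {k : Type u} [Field k] (C : SmallCompositionAlgebra k) : SmallClasses k :=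
  Quotient.mk (isoSetoid k) C

/-- The norm of `C` is isometric to the diagonal form `⟨w₀, …, w_{n-1}⟩`. -/
def HasNorm {k : Type u} [Field k] (C : SmallCompositionAlgebra k) {n : ℕ} (w : Fin n → k) :
    Prop :=
  QuadraticMap.Equivalent C.1.norm (QuadraticMap.weightedSumSquares k w)

end SixSymplectic

end

/-!
In block coordinates `x = (x₀, A, B, y₀)`, every nonzero null vector is `Sp₆`-equivalent to some
`(0, A, 0, 0)` with `A ≠ 0` symmetric, and the elements `diag(P, P⁻ᵀ)` allow one to replace `A` by
`c G A Gᵀ` for any `c ≠ 0` and any invertible `G`. Taking `G = 1` shows that scalars do not enlarge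
the orbits, and diagonalising `A` gives the normal forms.

Conversely the quadratic form `u ↦ ⟨τ_u x, x⟩` on `V`, with `τ_u` the transvection in `u` and
`⟨·, ·⟩` the invariant form on `⋀³ V`, is a covariant of `x`. On `(0, A, 0, 0)` it is essentially
the adjugate `A^#`, so the orbit determines the class of `A^#`; for the normal form with `A` of rank
`1`, `2`, `3` this is a form of rank `0`, `1`, `3`. It is the norm form, up to sign in rank `1`, on
the pure elements of a composition algebra of dimension `1`, `2`, `4`. Such an algebra is generated
by an orthogonal family of pure elements, so it is determined by that form as well.
-/

noncomputable section

namespace SixSymplectic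

open Matrix

universe u

/-! ### Adjugates of `3 × 3` matrices -/

section Adjugate

variable {R : Type*} [CommRing R]

/-- The Freudenthal product `A × B`, i.e. the polarization of the adjugate of `3 × 3` matrices,
normalised so that `A × A = 2 A^#`. -/
def adjugatePolar (A B : Matrix (Fin 3) (Fin 3) R) : Matrix (Fin 3) (Fin 3) R :=
  A * B + B * A - A.trace • B - B.trace • A + (A.trace * B.trace - (A * B).trace) • 1

theorem adjugate_add_fin_three (A B : Matrix (Fin 3) (Fin 3) R) :
    (A + B).adjugate = A.adjugate + B.adjugate + adjugatePolar A B := by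
  ext i j
  fin_cases i <;> fin_cases j <;>
    simp [adjugatePolar, adjugate_fin_three, mul_apply, trace_fin_three, Fin.sum_univ_three] <;>
    ring

theorem adjugate_vecMulVec (v w : Fin 3 → R) : (vecMulVec v w).adjugate = 0 := by
  ext i j
  fin_cases i <;> fin_cases j <;> simp [adjugate_fin_three, vecMulVec_apply] <;> ring

theorem det_add_fin_three (A B : Matrix (Fin 3) (Fin 3) R) :
    (A + B).det = A.det + (A.adjugate * B).trace + (A * B.adjugate).trace + B.det := by
  simp [adjugate_fin_three, det_fin_three, mul_apply, trace_fin_three, Fin.sum_univ_three,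
    vecMul, dotProduct]
  ring

theorem det_neg_fin_three (A : Matrix (Fin 3) (Fin 3) R) : (-A).det = -A.det := by
  simp [det_neg, Odd.neg_one_pow (by decide : Odd 3)]

theorem adjugate_neg_fin_three (A : Matrix (Fin 3) (Fin 3) R) : (-A).adjugate = A.adjugate := by
  rw [← neg_one_smul R, adjugate_smul]
  simp

theorem isLinearMap_adjugatePolar (S : Matrix (Fin 3) (Fin 3) R) :
    IsLinearMap R fun A => adjugatePolar A S where
  map_add A B := by
    simp only [adjugatePolar, add_mul, mul_add, trace_add]
    module
  map_smul c A := by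
    simp only [adjugatePolar, smul_mul_assoc, mul_smul_comm, trace_smul, smul_eq_mul]
    module

theorem adjugatePolar_comm (A B : Matrix (Fin 3) (Fin 3) R) :
    adjugatePolar A B = adjugatePolar B A := by
  simp only [adjugatePolar, trace_mul_comm A B]
  module

theorem isLinearMap_adjugatePolar_right (A : Matrix (Fin 3) (Fin 3) R) :
    IsLinearMap R (adjugatePolar A) := by
  rw [funext (adjugatePolar_comm A)]
  exact isLinearMap_adjugatePolar A

theorem adjugatePolar_self (A : Matrix (Fin 3) (Fin 3) R) :
    adjugatePolar A A = (2 : R) • A.adjugate := by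
  ext i j
  fin_cases i <;> fin_cases j <;>
    simp [adjugatePolar, adjugate_fin_three, mul_apply, trace_fin_three, Fin.sum_univ_three] <;>
    ring

theorem adjugatePolar_mul_mul (A B P : Matrix (Fin 3) (Fin 3) R) :
    adjugatePolar (A * P) (B * P) = P.adjugate * adjugatePolar A B := by
  have h := adjugate_add_fin_three (A * P) (B * P)
  rw [← add_mul, adjugate_mul_distrib, adjugate_add_fin_three A B, mul_add, mul_add,
    ← adjugate_mul_distrib, ← adjugate_mul_distrib] at h
  exact (add_left_cancel h).symm

theorem mul_adjugatePolar (U W S : Matrix (Fin 3) (Fin 3) R) :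
    W * adjugatePolar U (S * W) = adjugatePolar (U * W.adjugate) S := by
  ext i j
  fin_cases i <;> fin_cases j <;>
    simp [adjugatePolar, adjugate_fin_three, mul_apply, trace_fin_three, Fin.sum_univ_three] <;>
    ring

theorem trace_adjugatePolar_mul_self (A S : Matrix (Fin 3) (Fin 3) R) :
    (adjugatePolar A S * A).trace = 2 * (A.adjugate * S).trace := by
  simp [adjugatePolar, adjugate_fin_three, mul_apply, trace_fin_three, Fin.sum_univ_three,
    vecMul, dotProduct]
  ring

theorem trace_adjugatePolar_mul (A B C : Matrix (Fin 3) (Fin 3) R) :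
    (adjugatePolar A B * C).trace = (A * adjugatePolar B C).trace := by
  simp only [adjugatePolar, add_mul, mul_add, sub_mul, mul_sub, smul_mul_assoc, mul_smul_comm,
    trace_add, trace_sub, trace_smul, smul_eq_mul, one_mul, mul_one, Matrix.mul_assoc,
    trace_mul_cycle' A C B]
  ring

theorem adjugate_adjugatePolar_vecMulVec (B : Matrix (Fin 3) (Fin 3) R) (v w : Fin 3 → R) :
    (adjugatePolar B (vecMulVec v w)).adjugate =
      (B.adjugate * vecMulVec v w).trace • vecMulVec v w := by
  ext i j
  fin_cases i <;> fin_cases j <;>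
    simp [adjugatePolar, adjugate_fin_three, mul_apply, trace_fin_three,
      Fin.sum_univ_three, vecMul, dotProduct, vecMulVec_apply] <;> ring

theorem adjugate_adjugate_fin_three (A : Matrix (Fin 3) (Fin 3) R) :
    A.adjugate.adjugate = A.det • A := by
  simpa using adjugate_adjugate A (by simp)

theorem adjugatePolar_adjugatePolar_vecMulVec (B : Matrix (Fin 3) (Fin 3) R) (v w : Fin 3 → R) :
    adjugatePolar (adjugatePolar B (vecMulVec v w)) B.adjugate =
      B.det • vecMulVec v w + (B.adjugate * vecMulVec v w).trace • B := by
  have h := adjugate_adjugate_fin_three (B + vecMulVec v w)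
  rw [adjugate_add_fin_three, adjugate_vecMulVec, add_zero, adjugate_add_fin_three,
    adjugate_adjugate_fin_three, adjugate_adjugatePolar_vecMulVec, det_add_fin_three,
    adjugate_vecMulVec, det_vecMulVec, mul_zero, trace_zero] at h
  rw [adjugatePolar_comm, eq_sub_of_add_eq' h]
  module

theorem trace_adjugate_add_mul_adjugate (A B : Matrix (Fin 3) (Fin 3) R) (v w : Fin 3 → R) :
    ((A + adjugatePolar B (vecMulVec v w)).adjugate * B.adjugate).trace =
      (A.adjugate * B.adjugate).trace + (B.adjugate * vecMulVec v w).trace ^ 2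
        + B.det * (A * vecMulVec v w).trace
        + (B.adjugate * vecMulVec v w).trace * (A * B).trace := by
  rw [adjugate_add_fin_three, adjugate_adjugatePolar_vecMulVec, add_mul, trace_add, add_mul,
    trace_add, trace_adjugatePolar_mul, adjugatePolar_adjugatePolar_vecMulVec, mul_add, trace_add,
    trace_mul_comm B.adjugate (vecMulVec v w)]
  simp only [smul_mul_assoc, mul_smul_comm, trace_smul, smul_eq_mul]
  ring

end Adjugate

variable {k : Type u} [Field k]

/-! ### Block coordinates on `⋀³ V` -/

/-- The upper half, as a matrix with columns indexed by `a`, of a triple of vectors of `V`. -/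
def inlPart (v : Fin 3 → V k) : Matrix (Fin 3) (Fin 3) k := of fun i a => v a (.inl i)

/-- The lower half, as a matrix with columns indexed by `a`, of a triple of vectors of `V`. -/
def inrPart (v : Fin 3 → V k) : Matrix (Fin 3) (Fin 3) k := of fun i a => v a (.inr i)

/-- The type of the quadruples `(x₀, A, B, y₀)`. -/
abbrev Blocks (k : Type*) : Type _ :=
  k × Matrix (Fin 3) (Fin 3) k × Matrix (Fin 3) (Fin 3) k × k

/-- The coordinates `(x₀, A, B, y₀)` of an element of `⋀³ V`. -/
def blocks : Wedge3 k →ₗ[k] Blocks k where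
  toFun x := (x0 x, matA x, matB x, y0 x)
  map_add' x y := by
    simp only [x0, matA, matB, y0, map_add, neg_add, Prod.mk_add_mk, of_add_of]
    rfl
  map_smul' c x := by
    simp only [x0, matA, matB, y0, map_smul, RingHom.id_apply, Prod.smul_mk, smul_neg, smul_of]
    rfl

theorem blocks_apply (x : Wedge3 k) : blocks x = (x0 x, matA x, matB x, y0 x) := rfl

theorem coord_ιMulti (s : Fin 3 → Fin 3 ⊕ Fin 3) (v : Fin 3 → V k) :
    coord s (exteriorPower.ιMulti k 3 v) = (of fun a b => v a (s b)).det := by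
  simp only [coord, exteriorPower.alternatingMapLinearEquiv_apply_ιMulti]
  rfl

theorem det_updateCol_transpose {n : Type*} [Fintype n] [DecidableEq n] (M N : Matrix n n k)
    (i j : n) : (Mᵀ.updateCol j (N.row i)).det = (N * M.adjugate) i j := by
  rw [← cramer_apply, cramer_eq_adjugate_mulVec, ← adjugate_transpose, mulVec_transpose]
  rfl

theorem blocks_ιMulti (v : Fin 3 → V k) :
    blocks (exteriorPower.ιMulti k 3 v) =
      (-(inlPart v).det, inrPart v * (inlPart v).adjugate,
        inlPart v * (inrPart v).adjugate, -(inrPart v).det) := by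
  have hA (i j) : (of fun a b => v a (Function.update Sum.inl j (Sum.inr i) b)) =
      (inlPart v)ᵀ.updateCol j ((inrPart v).row i) := by
    ext a b
    obtain rfl | h := eq_or_ne b j
    · simp [inrPart]
    · simp [h, inlPart]
  have hB (i j) : (of fun a b => v a (Function.update Sum.inr j (Sum.inl i) b)) =
      (inrPart v)ᵀ.updateCol j ((inlPart v).row i) := by
    ext a b
    obtain rfl | h := eq_or_ne b j
    · simp [inlPart]
    · simp [h, inrPart]
  refine Prod.ext ?_ (Prod.ext ?_ (Prod.ext ?_ ?_))
  · simp only [blocks_apply, x0, coord_ιMulti, ← det_transpose (inlPart v)]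
    rfl
  · ext i j
    simp only [blocks_apply, matA, of_apply, coord_ιMulti, hA, det_updateCol_transpose]
  · ext i j
    simp only [blocks_apply, matB, of_apply, coord_ιMulti, hB, det_updateCol_transpose]
  · simp only [blocks_apply, y0, coord_ιMulti, ← det_transpose (inrPart v)]
    rfl

theorem eq_comp_blocks {N : Type*} [AddCommGroup N] [Module k N] (f : Wedge3 k →ₗ[k] N)
    {F : Blocks k → N} (hF : IsLinearMap k F)
    (h : ∀ v, f (exteriorPower.ιMulti k 3 v) = F (blocks (exteriorPower.ιMulti k 3 v)))
    (x : Wedge3 k) : f x = F (blocks x) := by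
  have : f = (IsLinearMap.mk' F hF).comp blocks :=
    exteriorPower.linearMap_ext (AlternatingMap.ext h)
  exact congr($this x)

theorem coord_comp_perm (s : Fin 3 → Fin 3 ⊕ Fin 3) (σ : Equiv.Perm (Fin 3)) (x : Wedge3 k) :
    coord (s ∘ σ) x = Equiv.Perm.sign σ * coord s x := by
  have : coord (k := k) (s ∘ σ) = ((Equiv.Perm.sign σ : ℤ) : k) • coord s := by
    refine exteriorPower.linearMap_ext (AlternatingMap.ext fun v => ?_)
    simp only [LinearMap.compAlternatingMap_apply, LinearMap.smul_apply, coord_ιMulti]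
    exact det_permute' σ (of fun a b => v a (s b))
  exact congr($this x)

theorem coord_eq_zero_of_blocks_eq_zero {x : Wedge3 k} (hx : blocks x = 0)
    {t : Fin 3 → Fin 3 ⊕ Fin 3} (ht : StrictMono (finSumFinEquiv ∘ t)) : coord t x = 0 := by
  simp only [blocks_apply, Prod.mk_eq_zero, x0, y0, neg_eq_zero] at hx
  obtain ⟨hx0, hA, hB, hy0⟩ := hx
  have hA (i j) : coord (Function.update Sum.inl j (Sum.inr i)) x = 0 := congr($hA i j)
  have hB (i j) : coord (Function.update Sum.inr j (Sum.inl i)) x = 0 := congr($hB i j)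
  have h01 : finSumFinEquiv (t 0) < finSumFinEquiv (t 1) := ht (by decide)
  have h12 : finSumFinEquiv (t 1) < finSumFinEquiv (t 2) := ht (by decide)
  -- Up to a permutation `σ` of its positions, `t` is the index triple of one of the blocks.
  suffices h : ∃ (s : Fin 3 → Fin 3 ⊕ Fin 3) (σ : Equiv.Perm (Fin 3)), t = s ∘ σ ∧ coord s x = 0 by
    obtain ⟨s, σ, rfl, hs⟩ := h
    rw [coord_comp_perm, hs, mul_zero]
  have hperm₀ : ∀ i j : Fin 3, i < j → ∃ σ : Equiv.Perm (Fin 3), σ 0 = i ∧ σ 1 = j := by decide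
  have hperm₁ : ∀ i j : Fin 3, i < j → ∃ σ : Equiv.Perm (Fin 3), σ 1 = i ∧ σ 2 = j := by decide
  have hperm₂ : ∀ i j l : Fin 3, i < j → j < l → i = 0 ∧ j = 1 ∧ l = 2 := by decide
  rcases h0 : t 0 with i | i <;> rcases h1 : t 1 with j | j <;> rcases h2 : t 2 with l | l <;>
    simp only [h0, h1, h2, finSumFinEquiv_apply_left, finSumFinEquiv_apply_right, Fin.lt_def,
      Fin.val_castAdd, Fin.val_natAdd, add_lt_add_iff_left] at h01 h12
  · obtain ⟨rfl, rfl, rfl⟩ := hperm₂ i j l h01 h12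
    exact ⟨_, 1, by ext a; fin_cases a <;> assumption, hx0⟩
  · obtain ⟨σ, rfl, rfl⟩ := hperm₀ i j h01
    exact ⟨_, σ, by ext a; fin_cases a <;> simp [*], hA l (σ 2)⟩
  · omega
  · obtain ⟨σ, rfl, rfl⟩ := hperm₁ j l h12
    exact ⟨_, σ, by ext a; fin_cases a <;> simp [*], hB i (σ 0)⟩
  · omega
  · omega
  · omega
  · obtain ⟨rfl, rfl, rfl⟩ := hperm₂ i j l h01 h12
    exact ⟨_, 1, by ext a; fin_cases a <;> assumption, hy0⟩

theorem blocks_injective : Function.Injective (blocks (k := k)) := by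
  refine (injective_iff_map_eq_zero _).mpr fun x hx => ?_
  let b := (Pi.basisFun k (Fin 3 ⊕ Fin 3)).reindex finSumFinEquiv
  refine (b.exteriorPower 3).repr.map_eq_zero_iff.mp (Finsupp.ext fun s => ?_)
  let t : Fin 3 → Fin 3 ⊕ Fin 3 := fun j =>
    finSumFinEquiv.symm (Set.powersetCard.ofFinEmbEquiv.symm s j)
  have hdual : exteriorPower.ιMultiDual k 3 b s = coord t := by
    refine exteriorPower.linearMap_ext (AlternatingMap.ext fun v => ?_)
    simp only [LinearMap.compAlternatingMap_apply, exteriorPower.ιMultiDual_apply_ιMulti,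
      coord_ιMulti]
    congr 1
  rw [exteriorPower.basis_repr_apply, hdual]
  refine coord_eq_zero_of_blocks_eq_zero hx fun i j hij => ?_
  simpa [t] using hij

/-! ### The action in block coordinates -/

theorem det_add_mul {R : Type*} [CommRing R] (U W S : Matrix (Fin 3) (Fin 3) R) :
    (U + S * W).det = U.det + (W * U.adjugate * S).trace + (U * W.adjugate * S.adjugate).trace +
      W.det * S.det := by
  rw [det_add_fin_three, det_mul, adjugate_mul_distrib, ← Matrix.mul_assoc U.adjugate,
    trace_mul_comm _ W, ← Matrix.mul_assoc, ← Matrix.mul_assoc, mul_comm S.det]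

theorem mul_adjugate_add_mul {R : Type*} [CommRing R] (U W S : Matrix (Fin 3) (Fin 3) R) :
    W * (U + S * W).adjugate =
      W * U.adjugate + adjugatePolar (U * W.adjugate) S + W.det • S.adjugate := by
  rw [adjugate_add_fin_three, mul_add, mul_add, mul_adjugatePolar, adjugate_mul_distrib,
    ← Matrix.mul_assoc, mul_adjugate, smul_mul_assoc, one_mul]
  abel

theorem add_mul_mul_adjugate {R : Type*} [CommRing R] (U W S : Matrix (Fin 3) (Fin 3) R) :
    (U + S * W) * W.adjugate = U * W.adjugate + W.det • S := by
  rw [add_mul, Matrix.mul_assoc, mul_adjugate, mul_smul_comm, mul_one]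

theorem act_ιMulti (g : Matrix (Fin 3 ⊕ Fin 3) (Fin 3 ⊕ Fin 3) k) (v : Fin 3 → V k) :
    act g (exteriorPower.ιMulti k 3 v) = exteriorPower.ιMulti k 3 (fun a => g *ᵥ v a) := by
  simp only [act, exteriorPower.map_apply_ιMulti]
  rfl

theorem inlPart_mulVec (a b c d : Matrix (Fin 3) (Fin 3) k) (v : Fin 3 → V k) :
    inlPart (fun i => fromBlocks a b c d *ᵥ v i) = a * inlPart v + b * inrPart v := by
  ext i j
  simp only [inlPart, of_apply, fromBlocks_mulVec, Sum.elim_inl]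
  rfl

theorem inrPart_mulVec (a b c d : Matrix (Fin 3) (Fin 3) k) (v : Fin 3 → V k) :
    inrPart (fun i => fromBlocks a b c d *ᵥ v i) = c * inlPart v + d * inrPart v := by
  ext i j
  simp only [inrPart, of_apply, fromBlocks_mulVec, Sum.elim_inr]
  rfl

/-- The unipotent element `(1, S; 0, 1)`, for symmetric `S`. -/
def upper (S : Matrix (Fin 3) (Fin 3) k) (hS : S.IsSymm) : Sp6 k :=
  ⟨fromBlocks 1 S 0 1, by
    simp [SymplecticGroup.mem_iff, J, fromBlocks_transpose, fromBlocks_multiply, hS.eq]⟩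

/-- The unipotent element `(1, 0; T, 1)`, for symmetric `T`. -/
def lower (T : Matrix (Fin 3) (Fin 3) k) (hT : T.IsSymm) : Sp6 k :=
  ⟨fromBlocks 1 0 T 1, by
    simp [SymplecticGroup.mem_iff, J, fromBlocks_transpose, fromBlocks_multiply, hT.eq]⟩

/-- The block diagonal element `(P, 0; 0, P⁻ᵀ)`. -/
def levi (P : Matrix (Fin 3) (Fin 3) k) (hP : IsUnit P.det) : Sp6 k :=
  ⟨fromBlocks P 0 0 P⁻¹ᵀ, by
    simp [SymplecticGroup.mem_iff, J, fromBlocks_transpose, fromBlocks_multiply,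
      mul_nonsing_inv P hP, ← transpose_mul]⟩

theorem blocks_act_symJ {x : Wedge3 k} {α β : k} {A B : Matrix (Fin 3) (Fin 3) k}
    (hx : blocks x = (α, A, B, β)) :
    blocks (act (SymplecticGroup.symJ (Fin 3) k).1 x) = (-β, B, -A, α) := by
  have hF : IsLinearMap k fun p : Blocks k => (-p.2.2.2, p.2.2.1, -p.2.1, p.1) :=
    ⟨fun p q => by simp [add_comm], fun c p => by simp⟩
  refine (eq_comp_blocks (blocks ∘ₗ act _) hF (fun v => ?_) x).trans (by rw [hx])
  simp [act_ιMulti, J, blocks_ιMulti, inlPart_mulVec, inrPart_mulVec, SymplecticGroup.symJ,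
    det_neg_fin_three, adjugate_neg_fin_three]

theorem blocks_act_upper {S : Matrix (Fin 3) (Fin 3) k} (hS : S.IsSymm) {x : Wedge3 k} {α β : k}
    {A B : Matrix (Fin 3) (Fin 3) k} (hx : blocks x = (α, A, B, β)) :
    blocks (act (upper S hS).1 x) =
      (α - (A * S).trace - (B * S.adjugate).trace + β * S.det,
        A + adjugatePolar B S - β • S.adjugate, B - β • S, β) := by
  have hP := isLinearMap_adjugatePolar S
  have hF : IsLinearMap k fun p : Blocks k =>
      (p.1 - (p.2.1 * S).trace - (p.2.2.1 * S.adjugate).trace + p.2.2.2 * S.det,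
        p.2.1 + adjugatePolar p.2.2.1 S - p.2.2.2 • S.adjugate, p.2.2.1 - p.2.2.2 • S, p.2.2.2) :=
    { map_add p q := by
        simp only [Prod.fst_add, Prod.snd_add, Prod.mk_add_mk, add_mul, trace_add, hP.map_add]
        refine Prod.ext ?_ (Prod.ext ?_ (Prod.ext ?_ ?_)) <;> module
      map_smul c p := by
        simp only [Prod.smul_fst, Prod.smul_snd, Prod.smul_mk, smul_mul_assoc, trace_smul,
          hP.map_smul]
        refine Prod.ext ?_ (Prod.ext ?_ (Prod.ext ?_ ?_)) <;> module }
  refine (eq_comp_blocks (blocks ∘ₗ act _) hF (fun v => ?_) x).trans (by rw [hx])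
  simp only [LinearMap.comp_apply, act_ιMulti, upper, blocks_ιMulti, inlPart_mulVec,
    inrPart_mulVec, one_mul, zero_mul, zero_add, det_add_mul, mul_adjugate_add_mul,
    add_mul_mul_adjugate]
  refine Prod.ext (by ring) (Prod.ext ?_ (Prod.ext ?_ rfl)) <;> module

theorem blocks_act_lower {T : Matrix (Fin 3) (Fin 3) k} (hT : T.IsSymm) {x : Wedge3 k} {α β : k}
    {A B : Matrix (Fin 3) (Fin 3) k} (hx : blocks x = (α, A, B, β)) :
    blocks (act (lower T hT).1 x) =
      (α, A - α • T, B + adjugatePolar A T - α • T.adjugate,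
        β - (B * T).trace - (A * T.adjugate).trace + α * T.det) := by
  have hP := isLinearMap_adjugatePolar T
  have hF : IsLinearMap k fun p : Blocks k =>
      (p.1, p.2.1 - p.1 • T, p.2.2.1 + adjugatePolar p.2.1 T - p.1 • T.adjugate,
        p.2.2.2 - (p.2.2.1 * T).trace - (p.2.1 * T.adjugate).trace + p.1 * T.det) :=
    { map_add p q := by
        simp only [Prod.fst_add, Prod.snd_add, Prod.mk_add_mk, add_mul, trace_add, hP.map_add]
        refine Prod.ext ?_ (Prod.ext ?_ (Prod.ext ?_ ?_)) <;> module
      map_smul c p := by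
        simp only [Prod.smul_fst, Prod.smul_snd, Prod.smul_mk, smul_mul_assoc, trace_smul,
          hP.map_smul]
        refine Prod.ext ?_ (Prod.ext ?_ (Prod.ext ?_ ?_)) <;> module }
  refine (eq_comp_blocks (blocks ∘ₗ act _) hF (fun v => ?_) x).trans (by rw [hx])
  simp only [LinearMap.comp_apply, act_ιMulti, lower, blocks_ιMulti, inlPart_mulVec,
    inrPart_mulVec, one_mul, zero_mul, add_zero, add_comm (T * inlPart v), det_add_mul,
    mul_adjugate_add_mul, add_mul_mul_adjugate]
  refine Prod.ext rfl (Prod.ext ?_ (Prod.ext ?_ (by ring))) <;> module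

theorem adjugate_eq_det_smul_inv {n : Type*} [Fintype n] [DecidableEq n] {P : Matrix n n k}
    (hP : IsUnit P.det) : P.adjugate = P.det • P⁻¹ := by
  rw [inv_def, Ring.inverse_eq_inv', smul_smul, mul_inv_cancel₀ hP.ne_zero, one_smul]

theorem blocks_act_levi {P : Matrix (Fin 3) (Fin 3) k} (hP : IsUnit P.det) {x : Wedge3 k} {α β : k}
    {A B : Matrix (Fin 3) (Fin 3) k} (hx : blocks x = (α, A, B, β)) :
    blocks (act (levi P hP).1 x) =
      (P.det * α, P.det • (P⁻¹ᵀ * A * P⁻¹), P.det⁻¹ • (P * B * Pᵀ), P.det⁻¹ * β) := by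
  have hF : IsLinearMap k fun p : Blocks k =>
      (P.det * p.1, P.det • (P⁻¹ᵀ * p.2.1 * P⁻¹), P.det⁻¹ • (P * p.2.2.1 * Pᵀ),
        P.det⁻¹ * p.2.2.2) :=
    ⟨fun p q => by simp [mul_add, add_mul], fun c p => by simp [mul_left_comm, smul_comm c]⟩
  have hadj' : P⁻¹ᵀ.adjugate = P.det⁻¹ • Pᵀ := by
    rw [← adjugate_transpose, adjugate_eq_det_smul_inv (isUnit_nonsing_inv_det P hP),
      nonsing_inv_nonsing_inv P hP, det_nonsing_inv, Ring.inverse_eq_inv', transpose_smul]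
  refine (eq_comp_blocks (blocks ∘ₗ act _) hF (fun v => ?_) x).trans (by rw [hx])
  simp only [LinearMap.comp_apply, act_ιMulti, levi, blocks_ιMulti, inlPart_mulVec,
    inrPart_mulVec, zero_mul, zero_add, add_zero, det_mul, adjugate_mul_distrib,
    adjugate_eq_det_smul_inv hP, hadj', det_transpose, det_nonsing_inv, Ring.inverse_eq_inv',
    Matrix.mul_assoc, mul_neg, mul_smul_comm]

/-! ### The contraction, the invariant form and a quadratic covariant -/

theorem contraction_ιMulti (v : Fin 3 → V k) :
    contraction k (exteriorPower.ιMulti k 3 v) =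
      Q (v 1) (v 2) • v 0 - Q (v 0) (v 2) • v 1 + Q (v 0) (v 1) • v 2 := by
  simp only [contraction, exteriorPower.alternatingMapLinearEquiv_apply_ιMulti]
  rfl

/-- The vector `![M₁₂ - M₂₁, M₂₀ - M₀₂, M₀₁ - M₁₀]` representing the skew part of `M`. -/
def skewPart (M : Matrix (Fin 3) (Fin 3) k) : Fin 3 → k :=
  ![M 1 2 - M 2 1, M 2 0 - M 0 2, M 0 1 - M 1 0]

theorem isSymm_iff_skewPart_eq_zero {M : Matrix (Fin 3) (Fin 3) k} :
    M.IsSymm ↔ skewPart M = 0 := by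
  simp [skewPart, IsSymm.ext_iff, Fin.forall_fin_succ, sub_eq_zero]
  grind

theorem contraction_eq (x : Wedge3 k) :
    contraction k x = Sum.elim (skewPart (matA x)) (-skewPart (matB x)) := by
  have hF : IsLinearMap k fun p : Blocks k => Sum.elim (skewPart p.2.1) (-skewPart p.2.2.1) := by
    constructor <;> intros <;> ext (i | i) <;> fin_cases i <;> simp [skewPart] <;> ring
  refine eq_comp_blocks _ hF (fun v => ?_) x
  rw [contraction_ιMulti, blocks_ιMulti]
  ext (i | i) <;> fin_cases i <;>
    simp [skewPart, Q, inlPart, inrPart, adjugate_fin_three, mul_apply, Fin.sum_univ_three] <;> ring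

theorem mem_X_iff {x : Wedge3 k} : x ∈ X k ↔ (matA x).IsSymm ∧ (matB x).IsSymm := by
  rw [X, LinearMap.mem_ker, contraction_eq, isSymm_iff_skewPart_eq_zero,
    isSymm_iff_skewPart_eq_zero]
  simp [funext_iff]

theorem Q_eq (v w : V k) : Q v w = -(v ᵥ* J (Fin 3) k ⬝ᵥ w) := by
  rw [← dotProduct_mulVec]
  simp [Q, J, dotProduct, Fintype.sum_sum_type, fromBlocks_mulVec, neg_mulVec]
  ring

theorem vecMul_J_mulVec (g : Sp6 k) (v : V k) :
    (g.1 *ᵥ v) ᵥ* J (Fin 3) k ᵥ* g.1 = v ᵥ* J (Fin 3) k := by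
  rw [← vecMul_transpose, vecMul_vecMul, vecMul_vecMul, ← Matrix.mul_assoc,
    SymplecticGroup.mem_iff'.mp g.2]

theorem Q_mulVec (g : Sp6 k) (v w : V k) : Q (g.1 *ᵥ v) (g.1 *ᵥ w) = Q v w := by
  rw [Q_eq, Q_eq, dotProduct_mulVec, vecMul_J_mulVec]

theorem act_mul (g h : Matrix (Fin 3 ⊕ Fin 3) (Fin 3 ⊕ Fin 3) k) (x : Wedge3 k) :
    act (g * h) x = act g (act h x) := by
  simp only [act, toLin'_mul, exteriorPower.map_comp, LinearMap.comp_apply]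

instance : MulAction (Sp6 k) (Wedge3 k) where
  smul g := act g.1
  one_smul x := by
    change act 1 x = x
    simp only [act, toLin'_one, exteriorPower.map_id, LinearMap.id_apply]
  mul_smul g h := act_mul g.1 h.1

theorem spOrbit_eq_orbit (x : Wedge3 k) : spOrbit x = MulAction.orbit (Sp6 k) x :=
  Set.ext fun _ => exists_congr fun _ => eq_comm

theorem act_mem_spOrbit (g : Sp6 k) (x : Wedge3 k) : act g.1 x ∈ spOrbit x := ⟨g, rfl⟩

theorem spOrbit_eq_iff {x y : Wedge3 k} : spOrbit x = spOrbit y ↔ x ∈ spOrbit y := by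
  simp only [spOrbit_eq_orbit, MulAction.orbit_eq_iff]

/-- The `Sp₆`-invariant alternating form on `⋀³ V`, in block coordinates. -/
def pairing : Wedge3 k →ₗ[k] Wedge3 k →ₗ[k] k :=
  LinearMap.mk₂ k (fun x y => (blocks x).1 * (blocks y).2.2.2
      - ((blocks x).2.1ᵀ * (blocks y).2.2.1).trace + ((blocks x).2.2.1ᵀ * (blocks y).2.1).trace
      - (blocks x).2.2.2 * (blocks y).1)
    (fun x x' y => by simp [add_mul]; ring) (fun c x y => by simp; ring)
    (fun x y y' => by simp [mul_add]; ring) (fun c x y => by simp; ring)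

theorem pairing_apply (x y : Wedge3 k) :
    pairing x y = x0 x * y0 y - ((matA x)ᵀ * matB y).trace + ((matB x)ᵀ * matA y).trace
      - y0 x * x0 y := rfl

theorem of_Q_eq (v w : Fin 3 → V k) :
    of (fun a b => Q (v a) (w b)) = (inlPart v)ᵀ * inrPart w + -((inrPart v)ᵀ * inlPart w) := by
  ext a b
  simp [Q, inlPart, inrPart, mul_apply, Finset.sum_sub_distrib, ← sub_eq_add_neg]

theorem pairing_ιMulti (v w : Fin 3 → V k) :
    pairing (exteriorPower.ιMulti k 3 v) (exteriorPower.ιMulti k 3 w) =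
      (of fun a b => Q (v a) (w b)).det := by
  have hx := blocks_ιMulti v
  have hy := blocks_ιMulti w
  simp only [blocks_apply, Prod.mk.injEq] at hx hy
  obtain ⟨hx1, hx2, hx3, hx4⟩ := hx
  obtain ⟨hy1, hy2, hy3, hy4⟩ := hy
  rw [pairing_apply, of_Q_eq, det_add_fin_three, hx1, hx2, hx3, hx4, hy1, hy2, hy3, hy4]
  generalize inlPart v = U, inrPart v = W, inlPart w = U', inrPart w = W'
  have hA : ((Uᵀ * W').adjugate * (Wᵀ * U')).trace =
      ((W * U.adjugate)ᵀ * (U' * W'.adjugate)).trace := by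
    rw [adjugate_mul_distrib, transpose_mul, adjugate_transpose, Matrix.mul_assoc,
      trace_mul_comm, Matrix.mul_assoc, Matrix.mul_assoc, Matrix.mul_assoc]
  have hB : (Uᵀ * W' * (Wᵀ * U').adjugate).trace =
      ((U * W.adjugate)ᵀ * (W' * U'.adjugate)).trace := by
    rw [adjugate_mul_distrib, transpose_mul, adjugate_transpose, ← Matrix.mul_assoc,
      trace_mul_comm, Matrix.mul_assoc, Matrix.mul_assoc, ← Matrix.mul_assoc]
  rw [Matrix.mul_neg, trace_neg, hA, adjugate_neg_fin_three, hB, det_neg_fin_three, det_mul,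
    det_mul, det_transpose, det_transpose]
  ring

theorem pairing_act (g : Sp6 k) (x y : Wedge3 k) :
    pairing (act g.1 x) (act g.1 y) = pairing x y := by
  have : pairing.compl₁₂ (act g.1) (act g.1) = pairing (k := k) := by
    refine exteriorPower.linearMap_ext (AlternatingMap.ext fun v =>
      exteriorPower.linearMap_ext (AlternatingMap.ext fun w => ?_))
    simp [act_ιMulti, pairing_ιMulti, Q_mulVec]
  exact congr($this x y)

/-- The symplectic transvection `v ↦ v + Q(u, v) u`. -/
def transvection (u : V k) : Matrix (Fin 3 ⊕ Fin 3) (Fin 3 ⊕ Fin 3) k :=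
  1 - vecMulVec u (u ᵥ* J (Fin 3) k)

theorem transvection_mulVec (u v : V k) : transvection u *ᵥ v = v + Q u v • u := by
  rw [transvection, sub_mulVec, one_mulVec, vecMulVec_mulVec, Q_eq, op_smul_eq_smul, neg_smul,
    sub_eq_add_neg]

theorem transvection_mulVec_mul (g : Sp6 k) (u : V k) :
    transvection (g.1 *ᵥ u) * g.1 = g.1 * transvection u := by
  rw [transvection, transvection, sub_mul, mul_sub, vecMulVec_mul, mul_vecMulVec, vecMul_J_mulVec,
    one_mul, mul_one]

/-- A quadratic covariant: for each `x`, a quadratic form in `u ∈ V`. If `x` has blocks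
`(0, A, 0, 0)`, it is `-2 A^#` in the second half of `u`. -/
def covariant (x : Wedge3 k) (u : V k) : k := pairing (act (transvection u) x) x

theorem covariant_act (g : Sp6 k) (x : Wedge3 k) (u : V k) :
    covariant (act g.1 x) (g.1 *ᵥ u) = covariant x u := by
  rw [covariant, ← act_mul, transvection_mulVec_mul, act_mul, pairing_act, covariant]

theorem inlPart_transvection (p q : Fin 3 → k) (v : Fin 3 → V k) :
    inlPart (fun i => transvection (Sum.elim p q) *ᵥ v i) =
      inlPart v + vecMulVec p (p ᵥ* inrPart v - q ᵥ* inlPart v) := by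
  ext i a
  simp [transvection_mulVec, inlPart, inrPart, vecMulVec_apply, Q, vecMul, dotProduct, mul_comm]

theorem inrPart_transvection (p q : Fin 3 → k) (v : Fin 3 → V k) :
    inrPart (fun i => transvection (Sum.elim p q) *ᵥ v i) =
      inrPart v + vecMulVec q (p ᵥ* inrPart v - q ᵥ* inlPart v) := by
  ext i a
  simp [transvection_mulVec, inlPart, inrPart, vecMulVec_apply, Q, vecMul, dotProduct, mul_comm]

theorem vecMul_adjugate_add_vecMulVec (W : Matrix (Fin 3) (Fin 3) k) (q r : Fin 3 → k) :
    r ᵥ* (W + vecMulVec q r).adjugate = r ᵥ* W.adjugate := by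
  ext i
  fin_cases i <;>
    simp [adjugate_fin_three, vecMul, dotProduct, Fin.sum_univ_three, vecMulVec_apply] <;> ring

theorem matB_act_transvection (p q : Fin 3 → k) (x : Wedge3 k) :
    matB (act (transvection (Sum.elim p q)) x) =
      matB x + matB x * adjugatePolar 1 (vecMulVec q p) - vecMulVec p (q ᵥ* matB x)
        - adjugatePolar (matA x) (vecMulVec q q) - y0 x • vecMulVec p p := by
  have hP := isLinearMap_adjugatePolar (vecMulVec q q)
  have hF : IsLinearMap k fun b : Blocks k => b.2.2.1 +
      b.2.2.1 * adjugatePolar 1 (vecMulVec q p) - vecMulVec p (q ᵥ* b.2.2.1)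
        - adjugatePolar b.2.1 (vecMulVec q q) - b.2.2.2 • vecMulVec p p :=
    { map_add b b' := by
        simp only [Prod.fst_add, Prod.snd_add, add_mul, hP.map_add, vecMul_add, vecMulVec_add]
        module
      map_smul c b := by
        simp only [Prod.smul_fst, Prod.smul_snd, smul_mul_assoc, hP.map_smul, vecMul_smul,
          vecMulVec_smul]
        module }
  let matB' : Wedge3 k →ₗ[k] Matrix (Fin 3) (Fin 3) k :=
    LinearMap.fst k _ _ ∘ₗ LinearMap.snd k _ _ ∘ₗ LinearMap.snd k _ _ ∘ₗ blocks
  refine eq_comp_blocks (matB' ∘ₗ act _) hF (fun v => ?_) x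
  simp only [matB', LinearMap.comp_apply, LinearMap.fst_apply, LinearMap.snd_apply, act_ιMulti,
    blocks_ιMulti, inlPart_transvection, inrPart_transvection]
  generalize inlPart v = U, inrPart v = W
  have hpq : vecMulVec q (p ᵥ* W - q ᵥ* U) = vecMulVec q p * W - vecMulVec q q * U := by
    rw [vecMulVec_mul, vecMulVec_mul, vecMulVec_sub]
  have hp : (p ᵥ* W - q ᵥ* U) ᵥ* W.adjugate = W.det • p - q ᵥ* (U * W.adjugate) := by
    rw [sub_vecMul, vecMul_vecMul, vecMul_vecMul, mul_adjugate, vecMul_smul, vecMul_one]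
  have hW : adjugatePolar W (vecMulVec q p * W) =
      W.adjugate * adjugatePolar 1 (vecMulVec q p) := by
    rw [← adjugatePolar_mul_mul, one_mul]
  rw [add_mul, vecMulVec_mul, vecMul_adjugate_add_vecMulVec, hp, adjugate_add_fin_three,
    adjugate_vecMulVec, hpq, (isLinearMap_adjugatePolar_right W).map_sub, add_zero, mul_add,
    mul_sub, mul_adjugatePolar, hW, vecMulVec_sub, vecMulVec_smul, ← Matrix.mul_assoc]
  module

theorem covariant_of_blocks {x : Wedge3 k} {A : Matrix (Fin 3) (Fin 3) k} (hA : A.IsSymm)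
    (hx : blocks x = (0, A, 0, 0)) (p q : Fin 3 → k) :
    covariant x (Sum.elim p q) = -2 * (q ⬝ᵥ A.adjugate *ᵥ q) := by
  simp only [blocks_apply, Prod.mk.injEq] at hx
  obtain ⟨hx0, rfl, hB, hy0⟩ := hx
  have htr : ((adjugatePolar (matA x) (vecMulVec q q))ᵀ * matA x).trace =
      2 * (q ⬝ᵥ (matA x).adjugate *ᵥ q) := by
    rw [← trace_transpose, transpose_mul, transpose_transpose, hA.eq, trace_mul_comm,
      trace_adjugatePolar_mul_self, mul_vecMulVec, trace_vecMulVec, dotProduct_comm]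
  rw [covariant, pairing_apply, matB_act_transvection, hx0, hB, hy0]
  simp [htr]

/-! ### Tangent forms of null vectors -/

theorem exists_mul_mul_transpose_eq_diagonal (h2 : (2 : k) ≠ 0) {n : ℕ}
    {A : Matrix (Fin n) (Fin n) k} (hA : A.IsSymm) :
    ∃ (P : Matrix (Fin n) (Fin n) k) (d : Fin n → k), IsUnit P.det ∧ P * A * Pᵀ = diagonal d := by
  have : Invertible (2 : k) := invertibleOfNonzero h2
  obtain ⟨v, hv⟩ := LinearMap.BilinForm.exists_orthogonal_basis
    (B := toBilin' A) ⟨fun x y => (isSymm_toBilin'_iff_isSymm.mpr hA).eq x y⟩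
  let b := v.reindex (finCongr (by simp : Module.finrank k (Fin n → k) = n))
  refine ⟨of fun i => b i, fun i => toBilin' A (b i) (b i), ?_, ?_⟩
  · rw [← isUnit_iff_isUnit_det, ← linearIndependent_rows_iff_isUnit]
    exact b.linearIndependent
  · ext i j
    have hentry : (of (fun i => b i) * A * (of fun i => b i)ᵀ) i j = toBilin' A (b i) (b j) := by
      rw [toBilin'_apply', Matrix.mul_assoc]
      rfl
    rw [hentry, diagonal_apply]
    split_ifs with h
    · rw [h]
    · simp only [b, Module.Basis.reindex_apply]
      exact hv (by simpa using h)

theorem mul_mul_transpose_eq_zero_iff {n : ℕ} {P A : Matrix (Fin n) (Fin n) k}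
    (hP : IsUnit P.det) : P * A * Pᵀ = 0 ↔ A = 0 := by
  rw [← isUnit_iff_isUnit_det] at hP
  rw [((isUnit_transpose P).mpr hP).mul_left_eq_zero, hP.mul_right_eq_zero]

theorem exists_dotProduct_mulVec_ne_zero (h2 : (2 : k) ≠ 0) {n : ℕ} {A : Matrix (Fin n) (Fin n) k}
    (hA : A.IsSymm) (hA0 : A ≠ 0) : ∃ v, v ⬝ᵥ A *ᵥ v ≠ 0 := by
  obtain ⟨P, d, hP, hd⟩ := exists_mul_mul_transpose_eq_diagonal h2 hA
  by_contra! h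
  have hd0 : d = 0 := funext fun i => by
    rw [← diagonal_apply_eq d i, ← hd, Matrix.mul_assoc]
    exact h (P i)
  exact hA0 ((mul_mul_transpose_eq_zero_iff hP).mp (by rw [hd, hd0, diagonal_zero']))

theorem quarticJ_of_blocks {x : Wedge3 k} {α β : k} {A B : Matrix (Fin 3) (Fin 3) k}
    (hx : blocks x = (α, A, B, β)) :
    quarticJ x = α * B.det + β * A.det + (A.adjugate * B.adjugate).trace
      - (1 / 4) * (α * β - (A * B).trace) ^ 2 := by
  simp only [blocks_apply, Prod.mk.injEq] at hx
  obtain ⟨rfl, rfl, rfl, rfl⟩ := hx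
  rfl

/-- The orbit of `x` contains the vector with blocks `(0, A, 0, 0)`. These vectors are the
tangent vectors at `e₁e₂e₃` to the cone over the Lagrangian Grassmannian, modulo `e₁e₂e₃`, and `A`
is the corresponding quadratic form on the Lagrangian `⟨e₁, e₂, e₃⟩`. -/
def IsTangentForm (x : Wedge3 k) (A : Matrix (Fin 3) (Fin 3) k) : Prop :=
  ∃ y ∈ spOrbit x, blocks y = (0, A, 0, 0)

/-- `x` has a nonzero symmetric tangent form. -/
def HasTangentForm (x : Wedge3 k) : Prop :=
  ∃ A : Matrix (Fin 3) (Fin 3) k, A.IsSymm ∧ A ≠ 0 ∧ IsTangentForm x A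

theorem isTangentForm_of_blocks {x : Wedge3 k} {A : Matrix (Fin 3) (Fin 3) k}
    (hx : blocks x = (0, A, 0, 0)) : IsTangentForm x A :=
  ⟨x, ⟨1, (one_smul (Sp6 k) x).symm⟩, hx⟩

theorem IsTangentForm.of_act {x : Wedge3 k} {A : Matrix (Fin 3) (Fin 3) k} (g : Sp6 k)
    (h : IsTangentForm (act g.1 x) A) : IsTangentForm x A := by
  rwa [IsTangentForm, spOrbit_eq_iff.mpr (act_mem_spOrbit g x)] at h

theorem HasTangentForm.of_act {x : Wedge3 k} (g : Sp6 k) (h : HasTangentForm (act g.1 x)) :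
    HasTangentForm x := by
  obtain ⟨A, hA, hA0, hxA⟩ := h
  exact ⟨A, hA, hA0, hxA.of_act g⟩

theorem hasTangentForm_of_blocks_zero_zero (h2 : (2 : k) ≠ 0) {x : Wedge3 k} {α : k}
    {A : Matrix (Fin 3) (Fin 3) k} (hx : blocks x = (α, A, 0, 0)) (hA : A.IsSymm) (hA0 : A ≠ 0) :
    HasTangentForm x := by
  obtain ⟨v, hv⟩ := exists_dotProduct_mulVec_ne_zero h2 hA hA0
  have hS : ((α / (v ⬝ᵥ A *ᵥ v)) • vecMulVec v v).IsSymm := IsSymm.smul (transpose_vecMulVec v v) _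
  refine ⟨A, hA, hA0, .of_act (upper _ hS) (isTangentForm_of_blocks ?_)⟩
  have htr : (A * vecMulVec v v).trace = v ⬝ᵥ A *ᵥ v := by
    rw [mul_vecMulVec, trace_vecMulVec, dotProduct_comm]
  simp [blocks_act_upper hS hx, htr, div_mul_cancel₀ _ hv,
    (isLinearMap_adjugatePolar _).map_zero]

theorem hasTangentForm_of_four_mul_det (h2 : (2 : k) ≠ 0) {x : Wedge3 k} {α β : k}
    {B : Matrix (Fin 3) (Fin 3) k} (hx : blocks x = (α, 0, B, β)) (hB : B.IsSymm) (hα : α ≠ 0)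
    (hβ : β ≠ 0) (hdet : 4 * B.det = α * β ^ 2) : HasTangentForm x := by
  have h4 : (4 : k) ≠ 0 := by simpa [show (4 : k) = 2 * 2 by norm_num] using h2
  have hdet0 : B.det ≠ 0 := fun h => by simp [h, hα, hβ] at hdet
  have hdet' : B.det = α * β ^ 2 / 4 := by rw [← hdet, mul_div_cancel_left₀ _ h4]
  have hadj : B.adjugate ≠ 0 := fun h => hdet0 (by
    simpa [h, eq_comm] using congr($(mul_adjugate B) 0 0))
  have hc : 2 / (α * β) ≠ 0 := div_ne_zero h2 (mul_ne_zero hα hβ)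
  have hT : ((2 / (α * β)) • B.adjugate).IsSymm := hB.adjugate.smul _
  refine .of_act (lower _ hT) (hasTangentForm_of_blocks_zero_zero h2 (α := α)
    (A := -(α • (2 / (α * β)) • B.adjugate)) ?_ (hT.smul α).neg (by simp [*]))
  rw [blocks_act_lower hT hx, (isLinearMap_adjugatePolar _).map_zero, adjugate_smul,
    adjugate_adjugate_fin_three, det_smul, det_adjugate, mul_smul_comm, mul_adjugate]
  simp only [Fintype.card_fin, trace_smul, trace_one, hdet', smul_eq_mul, zero_mul, trace_zero,
    zero_sub, add_zero, sub_zero, smul_smul, mul_assoc]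
  refine Prod.ext rfl (Prod.ext rfl (Prod.ext ?_ ?_))
  · have hc' : α * ((2 / (α * β)) ^ 2 * (α * β ^ 2 / 4)) = 1 := by
      field_simp
      norm_num
    rw [hc', one_smul, sub_self]
  · push_cast
    field_simp
    ring

theorem adjugatePolar_vecMulVec_self {D : Matrix (Fin 3) (Fin 3) k} {w : Fin 3 → k}
    (hw : w ⬝ᵥ w = 1) (hD : D *ᵥ w = 0) (hD' : w ᵥ* D = 0) :
    adjugatePolar D (vecMulVec w w) = D.trace • (1 - vecMulVec w w) - D := by
  rw [adjugatePolar, mul_vecMulVec, vecMulVec_mul, hD, hD', trace_vecMulVec, hw]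
  simp only [zero_vecMulVec, vecMulVec_zero, trace_zero]
  module

theorem hasTangentForm_of_mulVec_eq_zero (h2 : (2 : k) ≠ 0) {x : Wedge3 k} {α : k}
    {B : Matrix (Fin 3) (Fin 3) k} (hx : blocks x = (α, 0, B, 0)) (hB : B.IsSymm) (hα : α ≠ 0)
    {w : Fin 3 → k} (hw : w ⬝ᵥ w = 1) (hBw : B *ᵥ w = 0) : HasTangentForm x := by
  have hE : (vecMulVec w w).IsSymm := transpose_vecMulVec w w
  have hBw' : w ᵥ* B = 0 := by rw [← mulVec_transpose, hB.eq, hBw]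
  obtain ⟨M, hM⟩ : ∃ M, M = B.trace • (1 - vecMulVec w w) - B := ⟨_, rfl⟩
  have hMw : M *ᵥ w = 0 := by
    simp [hM, sub_mulVec, smul_mulVec, vecMulVec_mulVec, hw, hBw]
  have hwM : w ᵥ* M = 0 := by
    simp [hM, vecMul_sub, vecMul_smul, vecMul_vecMulVec, hw, hBw']
  have hy : blocks (act (upper _ hE).1 x) = (α, M, B, 0) := by
    rw [blocks_act_upper hE hx, adjugatePolar_vecMulVec_self hw hBw hBw', adjugate_vecMulVec]
    simp [hM]
  have hMs : M.IsSymm := hM ▸ ((isSymm_one.sub hE).smul _).sub hB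
  refine .of_act (upper _ hE) (.of_act (lower _ hE.neg) (hasTangentForm_of_blocks_zero_zero h2
    (α := α) (A := M + α • vecMulVec w w) ?_ (hMs.add (hE.smul α)) fun h => ?_))
  · have hB' : adjugatePolar M (vecMulVec w w) = B := by
      rw [adjugatePolar_vecMulVec_self hw hMw hwM, hM]
      simp only [trace_sub, trace_smul, trace_one, trace_vecMulVec, hw, Fintype.card_fin,
        smul_eq_mul]
      push_cast
      module
    rw [blocks_act_lower hE.neg hy, adjugate_neg_fin_three, adjugate_vecMulVec,
      det_neg_fin_three, det_vecMulVec, (isLinearMap_adjugatePolar_right M).map_neg, hB',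
      Matrix.mul_neg, mul_vecMulVec, hBw]
    simp
  · have hw0 : w = 0 := by
      simpa [add_mulVec, hMw, smul_mulVec, vecMulVec_mulVec, hw, hα] using congr($h *ᵥ w)
    simp [hw0] at hw

theorem hasTangentForm_of_det_eq_zero (h2 : (2 : k) ≠ 0) {x : Wedge3 k} {α : k}
    {B : Matrix (Fin 3) (Fin 3) k} (hx : blocks x = (α, 0, B, 0)) (hB : B.IsSymm) (hα : α ≠ 0)
    (hdet : B.det = 0) : HasTangentForm x := by
  obtain ⟨P, d, hP, hd⟩ := exists_mul_mul_transpose_eq_diagonal h2 hB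
  obtain ⟨i, hi⟩ : ∃ i, d i = 0 := by
    simpa [hdet, Finset.prod_eq_zero_iff, eq_comm (a := (0 : k))] using congr(Matrix.det $hd)
  refine .of_act (levi P hP) (hasTangentForm_of_mulVec_eq_zero h2 (α := P.det * α)
    (B := P.det⁻¹ • diagonal d) (w := Pi.single i 1) ?_ ((isSymm_diagonal d).smul _)
    (mul_ne_zero hP.ne_zero hα) (by simp) (funext fun j => by
      simp +contextual [diagonal_apply, hi]))
  rw [blocks_act_levi hP hx, hd]
  simp

theorem hasTangentForm_of_ne_zero (h2 : (2 : k) ≠ 0) {x : Wedge3 k} {α β : k}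
    {A B : Matrix (Fin 3) (Fin 3) k} (hx : blocks x = (α, A, B, β)) (hA : A.IsSymm) (hB : B.IsSymm)
    (hJ : quarticJ x = 0) (hα : α ≠ 0) : HasTangentForm x := by
  have h4 : (4 : k) ≠ 0 := by simpa [show (4 : k) = 2 * 2 by norm_num] using h2
  have hT : (α⁻¹ • A).IsSymm := hA.smul _
  obtain ⟨B', β', hB', hdet, hy⟩ : ∃ B' β', B'.IsSymm ∧ 4 * B'.det = α * β' ^ 2 ∧
      blocks (act (lower _ hT).1 x) = (α, 0, B', β') := by
    refine ⟨B + α⁻¹ • A.adjugate, β - α⁻¹ * (A * B).trace - 2 * α⁻¹ ^ 2 * A.det,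
      hB.add (hA.adjugate.smul _), ?_, ?_⟩
    · have hJ' : 4 * (α * B.det + β * A.det + (A.adjugate * B.adjugate).trace) =
          (α * β - (A * B).trace) ^ 2 := by
        rw [quarticJ_of_blocks hx] at hJ
        linear_combination 4 * hJ + (α * β - (A * B).trace) ^ 2 * mul_inv_cancel₀ h4
      simp only [det_add_fin_three, adjugate_smul, adjugate_adjugate_fin_three, det_smul,
        det_adjugate, mul_smul_comm, trace_smul, Fintype.card_fin, trace_mul_comm B,
        trace_mul_comm B.adjugate, smul_eq_mul, Nat.reduceSub]
      field_simp
      linear_combination α ^ 2 * hJ'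
    · rw [blocks_act_lower hT hx]
      simp only [adjugate_smul, det_smul, Fintype.card_fin, Nat.reduceSub]
      refine Prod.ext rfl (Prod.ext ?_ (Prod.ext ?_ ?_))
      · simp [hα]
      · rw [(isLinearMap_adjugatePolar_right A).map_smul, adjugatePolar_self]
        match_scalars <;> field_simp
        norm_num
      · dsimp only
        simp only [mul_smul_comm, trace_smul, trace_mul_comm B, mul_adjugate, trace_one,
          Fintype.card_fin, smul_eq_mul]
        field_simp
        push_cast
        ring
  refine .of_act (lower _ hT) ?_
  obtain rfl | hβ := eq_or_ne β' 0
  · exact hasTangentForm_of_det_eq_zero h2 hy hB' hα (by simpa [h4] using hdet)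
  · exact hasTangentForm_of_four_mul_det h2 hy hB' hα hβ hdet

theorem hasTangentForm_of_matA_ne_zero (h2 : (2 : k) ≠ 0) {x : Wedge3 k}
    {A B : Matrix (Fin 3) (Fin 3) k} (hx : blocks x = (0, A, B, 0)) (hA : A.IsSymm) (hB : B.IsSymm)
    (hA0 : A ≠ 0) (hJ : quarticJ x = 0) : HasTangentForm x := by
  have h4 : (4 : k) ≠ 0 := by simpa [show (4 : k) = 2 * 2 by norm_num] using h2
  obtain ⟨v, hv⟩ := exists_dotProduct_mulVec_ne_zero h2 hA hA0
  have hE : (vecMulVec v v).IsSymm := transpose_vecMulVec v v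
  have htr : (A * vecMulVec v v).trace = v ⬝ᵥ A *ᵥ v := by
    rw [mul_vecMulVec, trace_vecMulVec, dotProduct_comm]
  have hy : blocks (act (upper _ hE).1 x) =
      (-(A * vecMulVec v v).trace, A + adjugatePolar B (vecMulVec v v), B, 0) := by
    rw [blocks_act_upper hE hx, adjugate_vecMulVec]
    simp
  have hP : (adjugatePolar B (vecMulVec v v)).IsSymm := by
    rw [adjugatePolar, IsSymm]
    simp only [transpose_add, transpose_sub, transpose_mul, transpose_smul, hB.eq, hE.eq,
      transpose_one]
    abel
  refine .of_act (upper _ hE) (hasTangentForm_of_ne_zero h2 hy (hA.add hP) hB ?_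
    (neg_ne_zero.mpr (htr ▸ hv)))
  rw [quarticJ_of_blocks hx] at hJ
  rw [quarticJ_of_blocks hy, trace_adjugate_add_mul_adjugate, add_mul, trace_add,
    trace_adjugatePolar_mul_self]
  linear_combination hJ - ((B.adjugate * vecMulVec v v).trace * (A * B).trace
    + (B.adjugate * vecMulVec v v).trace ^ 2) * mul_inv_cancel₀ h4

theorem quarticJ_act_symJ (x : Wedge3 k) :
    quarticJ (act (SymplecticGroup.symJ (Fin 3) k).1 x) = quarticJ x := by
  rw [quarticJ_of_blocks (blocks_act_symJ (blocks_apply x)), quarticJ, det_neg_fin_three,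
    adjugate_neg_fin_three, trace_mul_comm (matB x).adjugate, Matrix.mul_neg, trace_neg,
    trace_mul_comm (matB x)]
  ring

theorem hasTangentForm_of_mem_nonzeroNullCone (h2 : (2 : k) ≠ 0) {x : Wedge3 k}
    (hx : x ∈ nonzeroNullCone k) : HasTangentForm x := by
  obtain ⟨hX, hJ, hx0⟩ := hx
  obtain ⟨hA, hB⟩ := mem_X_iff.mp hX
  obtain hα | hα := ne_or_eq (x0 x) 0
  · exact hasTangentForm_of_ne_zero h2 (blocks_apply x) hA hB hJ hα
  have hsymm := blocks_act_symJ (blocks_apply x)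
  rw [← quarticJ_act_symJ] at hJ
  obtain hβ | hβ := ne_or_eq (y0 x) 0
  · exact .of_act _ (hasTangentForm_of_ne_zero h2 hsymm hB hA.neg hJ (neg_ne_zero.mpr hβ))
  rw [hα, hβ, neg_zero] at hsymm
  obtain hB0 | hB0 := ne_or_eq (matB x) 0
  · exact .of_act _ (hasTangentForm_of_matA_ne_zero h2 hsymm hB hA.neg hB0 hJ)
  rw [quarticJ_act_symJ] at hJ
  have hx' : blocks x = (0, matA x, 0, 0) := by rw [blocks_apply, hα, hβ, hB0]
  refine ⟨matA x, hA, fun hA0 => hx0 (blocks_injective ?_), isTangentForm_of_blocks hx'⟩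
  rw [hx', hA0, map_zero, Prod.mk_zero_zero]
  rfl

theorem IsTangentForm.mem_spOrbit {x y : Wedge3 k} {A : Matrix (Fin 3) (Fin 3) k}
    (hx : IsTangentForm x A) (hy : IsTangentForm y A) : y ∈ spOrbit x := by
  obtain ⟨x', hx', hx'A⟩ := hx
  obtain ⟨y', hy', hy'A⟩ := hy
  obtain rfl := blocks_injective (hx'A.trans hy'A.symm)
  rw [← spOrbit_eq_iff] at hx' hy' ⊢
  exact hy'.symm.trans hx'

theorem IsTangentForm.smul {x : Wedge3 k} {A : Matrix (Fin 3) (Fin 3) k} (h : IsTangentForm x A)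
    (c : k) : IsTangentForm (c • x) (c • A) := by
  obtain ⟨_, ⟨g, rfl⟩, hA⟩ := h
  refine ⟨_, act_mem_spOrbit g (c • x), ?_⟩
  rw [map_smul, map_smul, hA]
  simp

theorem IsTangentForm.smul_mul_mul_transpose {x : Wedge3 k} {A : Matrix (Fin 3) (Fin 3) k}
    (h : IsTangentForm x A) {c : k} (hc : c ≠ 0) {G : Matrix (Fin 3) (Fin 3) k}
    (hG : IsUnit G.det) : IsTangentForm x (c • (G * A * Gᵀ)) := by
  obtain ⟨y, hy, hyA⟩ := h
  have hcG : c * G.det ≠ 0 := mul_ne_zero hc hG.ne_zero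
  have hinv : ((c * G.det) • G⁻¹ᵀ)⁻¹ = (c * G.det)⁻¹ • Gᵀ := inv_eq_left_inv <| by
    rw [smul_mul_smul_comm, inv_mul_cancel₀ hcG, ← transpose_mul, nonsing_inv_mul _ hG,
      transpose_one, one_smul]
  have hdet : ((c * G.det) • G⁻¹ᵀ).det = (c * G.det) ^ 3 * G.det⁻¹ := by
    rw [det_smul, det_transpose, det_nonsing_inv, Ring.inverse_eq_inv', Fintype.card_fin]
  have hP : IsUnit ((c * G.det) • G⁻¹ᵀ).det := by
    rw [hdet]
    exact ((isUnit_iff_ne_zero.mpr hcG).pow 3).mul hG.inv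
  refine ⟨_, spOrbit_eq_iff.mpr hy ▸ act_mem_spOrbit (levi _ hP) y, ?_⟩
  rw [blocks_act_levi hP hyA, hinv, hdet]
  simp only [mul_zero, Matrix.zero_mul, smul_zero, transpose_smul,
    transpose_transpose, smul_mul_assoc, mul_smul_comm, smul_smul]
  congr 3
  have := hG.ne_zero
  field_simp

theorem spGLOrbit_eq_spOrbit (h2 : (2 : k) ≠ 0) {x : Wedge3 k} (hx : x ∈ nonzeroNullCone k) :
    spGLOrbit x = spOrbit x := by
  obtain ⟨A, -, -, hA⟩ := hasTangentForm_of_mem_nonzeroNullCone h2 hx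
  refine Set.Subset.antisymm ?_ fun _ ⟨g, hy⟩ => ⟨⟨g, 1⟩, by simp [hy]⟩
  rintro _ ⟨⟨g, c⟩, rfl⟩
  have hcA : IsTangentForm x ((c : k) • A) := by
    simpa using hA.smul_mul_mul_transpose c.ne_zero (G := 1) (by simp)
  rw [← map_smul, ← spOrbit_eq_iff.mpr (hcA.mem_spOrbit (hA.smul c))]
  exact act_mem_spOrbit g _

theorem exists_adjugate_eq_mul_mul_transpose (h2 : (2 : k) ≠ 0) {x : Wedge3 k}
    {A B : Matrix (Fin 3) (Fin 3) k} (hA : A.IsSymm) (hB : B.IsSymm) (hxA : IsTangentForm x A)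
    (hxB : IsTangentForm x B) :
    ∃ G : Matrix (Fin 3) (Fin 3) k, A.adjugate = G * B.adjugate * Gᵀ := by
  obtain ⟨y, hy, hyA⟩ := hxA
  obtain ⟨z, hz, hzB⟩ := hxB
  rw [← spOrbit_eq_iff.mpr hy] at hz
  obtain ⟨g, rfl⟩ := hz
  refine ⟨g.1.toBlocks₂₂ᵀ, ?_⟩
  have hform (q : Fin 3 → k) : q ⬝ᵥ A.adjugate *ᵥ q =
      (g.1.toBlocks₂₂ *ᵥ q) ⬝ᵥ B.adjugate *ᵥ (g.1.toBlocks₂₂ *ᵥ q) := by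
    have hg : g.1 *ᵥ Sum.elim 0 q = Sum.elim (g.1.toBlocks₁₂ *ᵥ q) (g.1.toBlocks₂₂ *ᵥ q) := by
      conv_lhs => rw [← fromBlocks_toBlocks g.1, fromBlocks_mulVec]
      simp
    have h := covariant_act g y (Sum.elim 0 q)
    rw [hg, covariant_of_blocks hB hzB, covariant_of_blocks hA hyA] at h
    exact (mul_left_cancel₀ (neg_ne_zero.mpr h2) h).symm
  have hG : (g.1.toBlocks₂₂ᵀ * B.adjugate * g.1.toBlocks₂₂ᵀᵀ).IsSymm := by
    rw [IsSymm, transpose_mul, transpose_mul, transpose_transpose, hB.adjugate.eq,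
      Matrix.mul_assoc]
  by_contra hne
  obtain ⟨q, hq⟩ := exists_dotProduct_mulVec_ne_zero h2 (hA.adjugate.sub hG) (sub_ne_zero.mpr hne)
  refine hq ?_
  rw [sub_mulVec, dotProduct_sub, hform, sub_eq_zero, transpose_transpose, ← mulVec_mulVec,
    ← mulVec_mulVec, dotProduct_mulVec q, vecMul_transpose]

/-! ### Normal forms of null vectors -/

theorem blocks_rep2 (a : k) : blocks (rep2 a) = (1, 0, diagonal ![a, 0, 0], 0) := by
  rw [rep2, wedge, wedge, map_add, map_neg, map_smul, blocks_ιMulti, blocks_ιMulti]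
  refine Prod.ext ?_ (Prod.ext (Matrix.ext fun i j => ?_) (Prod.ext (Matrix.ext fun i j => ?_) ?_))
  · simp [inlPart, inrPart, e, det_fin_three, Pi.single_apply]
  · fin_cases i <;> fin_cases j <;> simp [inlPart, inrPart, e, mul_apply,
      adjugate_fin_three, Pi.single_apply, Fin.sum_univ_three]
  · fin_cases i <;> fin_cases j <;> simp [inlPart, inrPart, e, mul_apply,
      adjugate_fin_three, Pi.single_apply, Fin.sum_univ_three]
  · simp [inlPart, inrPart, e, det_fin_three, Pi.single_apply]

theorem blocks_rep4 (a b c : k) : blocks (rep4 a b c) = (0, diagonal ![a, b, c], 0, 0) := by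
  simp only [rep4, wedge, map_add, map_smul, blocks_ιMulti]
  refine Prod.ext ?_ (Prod.ext (Matrix.ext fun i j => ?_) (Prod.ext (Matrix.ext fun i j => ?_) ?_))
  · simp [inlPart, inrPart, e, det_fin_three, Pi.single_apply]
  · fin_cases i <;> fin_cases j <;> simp [inlPart, inrPart, e, mul_apply,
      adjugate_fin_three, Pi.single_apply, Fin.sum_univ_three]
  · fin_cases i <;> fin_cases j <;> simp [inlPart, inrPart, e, mul_apply,
      adjugate_fin_three, Pi.single_apply, Fin.sum_univ_three]
  · simp [inlPart, inrPart, e, det_fin_three, Pi.single_apply]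

theorem rep2_zero : rep2 (0 : k) = rep1 k := by
  rw [rep2, rep1, zero_smul, add_zero]

theorem mem_nonzeroNullCone_of_blocks {x : Wedge3 k} {α β : k} {A B : Matrix (Fin 3) (Fin 3) k}
    (hx : blocks x = (α, A, B, β)) (hA : A.IsSymm) (hB : B.IsSymm) (hJ : quarticJ x = 0)
    (h0 : (α, A, B, β) ≠ 0) : x ∈ nonzeroNullCone k := by
  refine ⟨mem_X_iff.mpr ?_, hJ, fun h => h0 (by rw [← hx, h, map_zero])⟩
  rw [blocks_apply, Prod.mk.injEq, Prod.mk.injEq, Prod.mk.injEq] at hx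
  exact ⟨hx.2.1 ▸ hA, hx.2.2.1 ▸ hB⟩

theorem rep2_mem_nonzeroNullCone (a : k) : rep2 a ∈ nonzeroNullCone k :=
  mem_nonzeroNullCone_of_blocks (blocks_rep2 a) isSymm_zero (isSymm_diagonal _)
    (by simp [quarticJ_of_blocks (blocks_rep2 a), Fin.prod_univ_three]) (by simp)

theorem rep1_mem_nonzeroNullCone : rep1 k ∈ nonzeroNullCone k :=
  rep2_zero (k := k) ▸ rep2_mem_nonzeroNullCone 0

theorem rep4_mem_nonzeroNullCone {a : k} (ha : a ≠ 0) (b c : k) :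
    rep4 a b c ∈ nonzeroNullCone k := by
  refine mem_nonzeroNullCone_of_blocks (blocks_rep4 a b c) (isSymm_diagonal _) isSymm_zero
    (by simp [quarticJ_of_blocks (blocks_rep4 a b c)]) fun h => ha ?_
  simpa using congr($h.2.1 0 0)

theorem isTangentForm_rep4 (a b c : k) :
    IsTangentForm (rep4 a b c) (diagonal ![a, b, c]) :=
  isTangentForm_of_blocks (blocks_rep4 a b c)

theorem adjugate_diagonal_fin_three (a b c : k) :
    (diagonal ![a, b, c]).adjugate = diagonal ![b * c, a * c, a * b] := by
  rw [adjugate_fin_three]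
  ext i j
  fin_cases i <;> fin_cases j <;> simp

theorem adjugatePolar_diagonal (a b c a' b' c' : k) :
    adjugatePolar (diagonal ![a, b, c]) (diagonal ![a', b', c']) =
      diagonal ![b * c' + c * b', a * c' + c * a', a * b' + b * a'] := by
  ext i j
  fin_cases i <;> fin_cases j <;> simp [adjugatePolar, Fin.sum_univ_three] <;> ring

theorem isTangentForm_rep2 (a : k) : IsTangentForm (rep2 a) (diagonal ![0, 1, a]) := by
  have hS : (diagonal ![0, 1, 0] : Matrix (Fin 3) (Fin 3) k).IsSymm := isSymm_diagonal _
  have hT : (diagonal ![0, -1, 0] : Matrix (Fin 3) (Fin 3) k).IsSymm := isSymm_diagonal _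
  have h₁ : blocks (act (upper _ hS).1 (rep2 a)) =
      (1, diagonal ![0, 0, a], diagonal ![a, 0, 0], 0) := by
    rw [blocks_act_upper hS (blocks_rep2 a), adjugatePolar_diagonal, adjugate_diagonal_fin_three]
    simp [Fin.sum_univ_three]
  have h₂ : blocks (act (lower _ hT).1 (act (upper _ hS).1 (rep2 a))) =
      (1, diagonal ![0, 1, a], 0, 0) := by
    rw [blocks_act_lower hT h₁, adjugatePolar_diagonal, adjugate_diagonal_fin_three]
    simp [Fin.forall_fin_succ, funext_iff, Fin.sum_univ_three, Fin.prod_univ_three]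
  refine .of_act (upper _ hS) (.of_act (lower _ hT)
    (.of_act (upper _ hS) (isTangentForm_of_blocks ?_)))
  rw [blocks_act_upper hS h₂]
  simp [Fin.sum_univ_three, (isLinearMap_adjugatePolar _).map_zero]

theorem IsTangentForm.diagonal_comp_perm {x : Wedge3 k} {d : Fin 3 → k}
    (h : IsTangentForm x (diagonal d)) (σ : Equiv.Perm (Fin 3)) :
    IsTangentForm x (diagonal (d ∘ σ)) := by
  have hσ : IsUnit (σ.permMatrix k).det := by
    rw [det_permutation]
    exact (Units.isUnit _).map (Int.castRingHom k)
  convert h.smul_mul_mul_transpose one_ne_zero hσ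
  rw [transpose_permMatrix]
  ext i j
  simp [diagonal_apply, PEquiv.toMatrix_toPEquiv_mul, PEquiv.mul_toMatrix_toPEquiv,
    Equiv.Perm.inv_def]

theorem exists_eq_smul_mul_mul_transpose {A B G : Matrix (Fin 3) (Fin 3) k} (hA : IsUnit A.det)
    (hB : IsUnit B.det) (hG : B.adjugate = G * A.adjugate * Gᵀ) :
    ∃ c : k, c ≠ 0 ∧ ∃ H : Matrix (Fin 3) (Fin 3) k, IsUnit H.det ∧ B = c • (H * A * Hᵀ) := by
  refine ⟨B.det⁻¹ * A.det, mul_ne_zero (inv_ne_zero hB.ne_zero) hA.ne_zero, Gᵀ.adjugate, ?_, ?_⟩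
  · have hdet : B.det ^ 2 = (G * A.adjugate).det * Gᵀ.det := by
      rw [← det_mul, ← hG, det_adjugate, Fintype.card_fin]
    rw [det_adjugate]
    exact (isUnit_of_mul_isUnit_right (hdet ▸ hB.pow 2)).pow _
  · have hadj : B.det • B = A.det • (Gᵀ.adjugate * A * G.adjugate) := by
      rw [← adjugate_adjugate_fin_three, hG, adjugate_mul_distrib, adjugate_mul_distrib,
        adjugate_adjugate_fin_three, smul_mul_assoc, mul_smul_comm, Matrix.mul_assoc]
    rw [adjugate_transpose, transpose_transpose, mul_smul, ← hadj, smul_smul,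
      inv_mul_cancel₀ hB.ne_zero, one_smul]

/-- The parameters of the three families of normal forms of nonzero null vectors; the constructor
`one`, `two` or `four` is the dimension of the composition algebra attached to the vector. -/
inductive NormalForm (k : Type u) [Field k] : Type u
  | one : NormalForm k
  | two (a : k) (ha : a ≠ 0) : NormalForm k
  | four (a b c : k) (ha : a ≠ 0) (hb : b ≠ 0) (hc : c ≠ 0) : NormalForm k

namespace NormalForm

/-- The vector with the given parameters. -/
def rep : NormalForm k → Wedge3 k
  | one => rep1 k
  | two a _ => rep2 a
  | four a b c _ _ _ => rep4 a b c

/-- The diagonal entries of a tangent form of `t.rep`. -/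
def tangentWeights : NormalForm k → Fin 3 → k
  | one => ![0, 1, 0]
  | two a _ => ![0, 1, a]
  | four a b c _ _ _ => ![a, b, c]

/-- The dimension of the space of pure elements of the composition algebra attached to `t`. -/
def pureDim : NormalForm k → ℕ
  | one => 0
  | two _ _ => 1
  | four _ _ _ _ _ _ => 3

/-- The diagonal entries of the norm form on the pure elements of the composition algebra
attached to `t`. -/
def pureWeights : (t : NormalForm k) → Fin t.pureDim → k
  | one => ![]
  | two a _ => ![-a]
  | four a b c _ _ _ => ![b * c, a * c, a * b]

theorem rep_mem_nonzeroNullCone (t : NormalForm k) : t.rep ∈ nonzeroNullCone k := by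
  cases t with
  | one => exact rep1_mem_nonzeroNullCone
  | two a => exact rep2_mem_nonzeroNullCone a
  | four a b c ha => exact rep4_mem_nonzeroNullCone ha b c

theorem isTangentForm_rep (t : NormalForm k) :
    IsTangentForm t.rep (diagonal t.tangentWeights) := by
  cases t with
  | one =>
    rw [rep, ← rep2_zero]
    exact isTangentForm_rep2 0
  | two a => exact isTangentForm_rep2 a
  | four a b c => exact isTangentForm_rep4 a b c

theorem exists_isTangentForm_diagonal {x : Wedge3 k} {d : Fin 3 → k} (hd : d ≠ 0)
    (h : IsTangentForm x (diagonal d)) :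
    ∃ t : NormalForm k, IsTangentForm x (diagonal t.tangentWeights) := by
  by_cases hall : ∀ i, d i ≠ 0
  · refine ⟨four (d 0) (d 1) (d 2) (hall 0) (hall 1) (hall 2), ?_⟩
    convert h
    ext i
    fin_cases i <;> rfl
  push Not at hall
  obtain ⟨i, hi⟩ := hall
  obtain ⟨j, hj⟩ : ∃ j, d j ≠ 0 := Function.ne_iff.mp hd
  have exists_perm : ∀ i j : Fin 3, i ≠ j → ∃ σ : Equiv.Perm (Fin 3), σ 0 = i ∧ σ 1 = j := by
    decide
  obtain ⟨σ, rfl, rfl⟩ := exists_perm i j fun h => hj (h ▸ hi)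
  have hxd : IsTangentForm x (diagonal ![0, 1, d (σ 2) / d (σ 1)]) := by
    convert (h.diagonal_comp_perm σ).smul_mul_mul_transpose (inv_ne_zero hj) (G := 1) (by simp)
    rw [transpose_one, Matrix.mul_one, Matrix.one_mul, ← diagonal_smul]
    congr 1
    ext l
    fin_cases l <;> simp [hi, inv_mul_cancel₀ hj, inv_mul_eq_div]
  obtain ha | ha := eq_or_ne (d (σ 2) / d (σ 1)) 0
  · rw [ha] at hxd
    exact ⟨one, hxd⟩
  · exact ⟨two _ ha, hxd⟩

theorem exists_rep_mem_spOrbit (h2 : (2 : k) ≠ 0) {x : Wedge3 k} (hx : x ∈ nonzeroNullCone k) :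
    ∃ t : NormalForm k, t.rep ∈ spOrbit x := by
  obtain ⟨A, hA, hA0, hxA⟩ := hasTangentForm_of_mem_nonzeroNullCone h2 hx
  obtain ⟨P, d, hP, hd⟩ := exists_mul_mul_transpose_eq_diagonal h2 hA
  have hd0 : d ≠ 0 := by
    rintro rfl
    rw [diagonal_zero', mul_mul_transpose_eq_zero_iff hP] at hd
    exact hA0 hd
  have hxd : IsTangentForm x (diagonal d) := by
    simpa [hd] using hxA.smul_mul_mul_transpose one_ne_zero hP
  obtain ⟨t, ht⟩ := exists_isTangentForm_diagonal hd0 hxd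
  exact ⟨t, ht.mem_spOrbit t.isTangentForm_rep⟩

/-- The norm forms on the pure elements attached to `s` and `t` are equivalent; it suffices that
the second one is the pullback of the first one under some `Gᵀ`, as both are nondegenerate. -/
def Congruent (s t : NormalForm k) : Prop :=
  s.pureDim = t.pureDim ∧ ∃ G : Matrix (Fin t.pureDim) (Fin s.pureDim) k,
    diagonal t.pureWeights = G * diagonal s.pureWeights * Gᵀ

theorem rank_adjugate_tangentWeights (t : NormalForm k) :
    (diagonal t.tangentWeights).adjugate.rank = t.pureDim := by
  classical
  cases t with
  | one =>
    rw [tangentWeights, adjugate_diagonal_fin_three, rank_diagonal, Fintype.card_subtype]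
    simp [pureDim, Fin.univ_succ, Finset.filter_insert, Finset.filter_singleton]
  | two a ha =>
    rw [tangentWeights, adjugate_diagonal_fin_three, rank_diagonal, Fintype.card_subtype]
    simp [pureDim, Fin.univ_succ, Finset.filter_insert, Finset.filter_singleton, ha]
  | four a b c ha hb hc =>
    rw [tangentWeights, adjugate_diagonal_fin_three, rank_diagonal, Fintype.card_subtype]
    simp [pureDim, Fin.univ_succ, Finset.filter_insert, Finset.filter_singleton, ha, hb, hc]

theorem congruent_two_two_iff {a b : k} {ha : a ≠ 0} {hb : b ≠ 0} :
    (two a ha).Congruent (two b hb) ↔ ∃ g, b = g * a * g := by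
  have hentry (G : Matrix (Fin 1) (Fin 1) k) :
      diagonal ![-b] = G * diagonal ![-a] * Gᵀ ↔ b = G 0 0 * a * G 0 0 := by
    simp [← Matrix.ext_iff, mul_apply]
  refine ⟨fun ⟨_, G, hG⟩ => ⟨_, (hentry G).mp hG⟩, fun ⟨g, hg⟩ => ⟨rfl, of ![![g]], ?_⟩⟩
  exact (hentry _).mpr hg

theorem congruent_of_rep_mem_spOrbit (h2 : (2 : k) ≠ 0) {s t : NormalForm k}
    (h : t.rep ∈ spOrbit s.rep) : s.Congruent t := by
  have hst : IsTangentForm s.rep (diagonal t.tangentWeights) := by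
    simpa [IsTangentForm, spOrbit_eq_iff.mpr h] using t.isTangentForm_rep
  obtain ⟨G, hG⟩ := exists_adjugate_eq_mul_mul_transpose h2 (isSymm_diagonal _) (isSymm_diagonal _)
    hst s.isTangentForm_rep
  obtain ⟨H, hH⟩ := exists_adjugate_eq_mul_mul_transpose h2 (isSymm_diagonal _) (isSymm_diagonal _)
    s.isTangentForm_rep hst
  have hdim : s.pureDim = t.pureDim := by
    rw [← rank_adjugate_tangentWeights, ← rank_adjugate_tangentWeights]
    refine le_antisymm ?_ ?_
    · rw [hH]
      exact (rank_mul_le_left _ _).trans (rank_mul_le_right _ _)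
    · rw [hG]
      exact (rank_mul_le_left _ _).trans (rank_mul_le_right _ _)
  refine ⟨hdim, ?_⟩
  cases s <;> cases t <;> simp [pureDim] at hdim
  case one.one => exact ⟨0, Matrix.ext fun i => i.elim0⟩
  case two.two =>
    rw [tangentWeights, tangentWeights, adjugate_diagonal_fin_three,
      adjugate_diagonal_fin_three] at hG
    refine (congruent_two_two_iff.mpr ⟨G 0 0, ?_⟩).2
    simpa [mul_apply, Fin.sum_univ_three] using congr($hG 0 0)
  case four.four =>
    rw [tangentWeights, tangentWeights, adjugate_diagonal_fin_three,
      adjugate_diagonal_fin_three] at hG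
    exact ⟨G, hG⟩

theorem rep_mem_spOrbit_of_congruent {s t : NormalForm k}
    (h : s.Congruent t) : t.rep ∈ spOrbit s.rep := by
  suffices ∃ c : k, c ≠ 0 ∧ ∃ H : Matrix (Fin 3) (Fin 3) k, IsUnit H.det ∧
      diagonal t.tangentWeights = c • (H * diagonal s.tangentWeights * Hᵀ) by
    obtain ⟨c, hc, H, hH, heq⟩ := this
    have ht := s.isTangentForm_rep.smul_mul_mul_transpose hc hH
    rw [← heq] at ht
    exact ht.mem_spOrbit t.isTangentForm_rep
  have ⟨hdim, G, hG⟩ := h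
  cases s <;> cases t <;> simp [pureDim] at hdim
  case one.one => exact ⟨1, one_ne_zero, 1, by simp, by simp⟩
  case two.two a ha b hb =>
    obtain ⟨g, rfl⟩ := congruent_two_two_iff.mp h
    refine ⟨1, one_ne_zero, diagonal ![1, 1, g], ?_, ?_⟩
    · simpa [Fin.prod_univ_three] using right_ne_zero_of_mul hb
    · simp [tangentWeights, Fin.forall_fin_succ]
  case four.four ha hb hc _ _ _ ha' hb' hc' =>
    refine exists_eq_smul_mul_mul_transpose (G := G) ?_ ?_ ?_
    · simp [tangentWeights, Fin.prod_univ_three, ha, hb, hc]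
    · simp [tangentWeights, Fin.prod_univ_three, ha', hb', hc']
    · rw [tangentWeights, tangentWeights, adjugate_diagonal_fin_three,
        adjugate_diagonal_fin_three]
      exact hG

end NormalForm

/-! ### Composition algebras -/

open QuadraticMap

namespace CompositionAlgebra

section Identities

variable (C : CompositionAlgebra k)

/-- The polar form `⟨x, y⟩ = N(x + y) - N(x) - N(y)` of the norm of `C`. -/
abbrev bil (x y : C.carrier) : k := polar C.norm x y

theorem norm_add (x y : C.carrier) : C.norm (x + y) = C.norm x + C.norm y + C.bil x y :=
  QuadraticMap.map_add C.norm x y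

theorem bil_self (x : C.carrier) : C.bil x x = 2 * C.norm x := by
  rw [bil, polar_self, nsmul_eq_mul, Nat.cast_ofNat]

theorem ext_bil {x y : C.carrier} (h : ∀ z, C.bil x z = C.bil y z) : x = y := by
  refine sub_eq_zero.mp (C.nondegenerate.1 (x - y) fun z => ?_)
  rw [polarBilin_apply_apply, polar_sub_left, sub_eq_zero]
  exact h z

theorem bil_mul_left (x y z : C.carrier) : C.bil (x * y) (x * z) = C.norm x * C.bil y z := by
  simp only [bil, polar, ← mul_add, C.norm_mul]
  ring

theorem bil_mul_right (x y z : C.carrier) : C.bil (x * z) (y * z) = C.bil x y * C.norm z := by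
  simp only [bil, polar, ← add_mul, C.norm_mul]
  ring

theorem bil_mul_mul (x y z w : C.carrier) :
    C.bil (x * y) (z * w) + C.bil (z * y) (x * w) = C.bil x z * C.bil y w := by
  have h := C.bil_mul_left (x + z) y w
  simp only [add_mul, bil, polar_add_left, polar_add_right] at h
  linear_combination h - C.bil_mul_left x y w - C.bil_mul_left z y w + C.bil y w * C.norm_add x z

theorem norm_one : C.norm 1 = 1 := by
  have hsq : C.norm 1 * C.norm 1 = C.norm 1 := by rw [← C.norm_mul, mul_one]
  refine (mul_right_eq_self₀.mp hsq).resolve_right fun h0 => ?_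
  have hnorm (x : C.carrier) : C.norm x = 0 := by
    rw [← mul_one x, C.norm_mul, h0, mul_zero]
  exact one_ne_zero (α := C.carrier) (C.ext_bil fun z => by simp [bil, polar, hnorm])

/-- The conjugate `⟨x, 1⟩ - x` of `x`. -/
def conj (x : C.carrier) : C.carrier := C.bil x 1 • 1 - x

theorem bil_mul_left_eq (x y z : C.carrier) : C.bil (x * y) z = C.bil y (C.conj x * z) := by
  have h := C.bil_mul_mul x y 1 z
  rw [one_mul, one_mul] at h
  simp only [conj, sub_mul, smul_mul_assoc, one_mul, bil, polar_sub_right, polar_smul_right,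
    smul_eq_mul] at h ⊢
  linear_combination h

theorem bil_mul_right_eq (x y z : C.carrier) : C.bil (y * x) z = C.bil y (z * C.conj x) := by
  have h := C.bil_mul_mul y x z 1
  rw [mul_one, mul_one, bil, bil, polar_comm _ (z * x)] at h
  simp only [conj, mul_sub, mul_smul_comm, mul_one, bil, polar_sub_right, polar_smul_right,
    smul_eq_mul] at h ⊢
  linear_combination h

theorem conj_mul_mul (x y : C.carrier) : C.conj x * (x * y) = C.norm x • y := by
  refine C.ext_bil fun z => ?_
  rw [bil, polar_comm, ← bil, ← C.bil_mul_left_eq x z, C.bil_mul_left]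
  simp only [bil, polar_smul_left, smul_eq_mul, polar_comm _ y z]

theorem mul_mul_conj (x y : C.carrier) : (y * x) * C.conj x = C.norm x • y := by
  refine C.ext_bil fun z => ?_
  rw [bil, polar_comm, ← bil, ← C.bil_mul_right_eq x z, C.bil_mul_right]
  simp only [bil, polar_smul_left, smul_eq_mul, polar_comm _ y z, mul_comm (C.norm x)]

theorem norm_conj (x : C.carrier) : C.norm (C.conj x) = C.norm x := by
  rw [conj, sub_eq_add_neg, C.norm_add, QuadraticMap.map_smul, C.norm_one, QuadraticMap.map_neg]
  simp only [bil, polar_smul_left, polar_neg_right, smul_eq_mul, polar_comm _ 1 x]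
  ring

theorem mul_self_eq (x : C.carrier) : x * x = C.bil x 1 • x - C.norm x • 1 := by
  have h := C.conj_mul_mul x 1
  rw [mul_one, conj, sub_mul, smul_mul_assoc, one_mul] at h
  rw [← h, sub_sub_cancel]

variable {C}

theorem mul_mul_of_bil_one_eq_zero {x : C.carrier} (hx : C.bil x 1 = 0) (y : C.carrier) :
    x * (x * y) = -C.norm x • y := by
  rw [neg_smul, ← C.conj_mul_mul x y, conj, hx, zero_smul, zero_sub, neg_mul, neg_neg]

theorem mul_mul_of_bil_one_eq_zero' {x : C.carrier} (hx : C.bil x 1 = 0) (y : C.carrier) :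
    (y * x) * x = -C.norm x • y := by
  rw [neg_smul, ← C.mul_mul_conj x y, conj, hx, zero_smul, zero_sub, mul_neg, neg_neg]

theorem mul_self_of_bil_one_eq_zero {x : C.carrier} (hx : C.bil x 1 = 0) :
    x * x = -C.norm x • 1 := by
  rw [C.mul_self_eq, hx, zero_smul, zero_sub, neg_smul]

theorem mul_eq_neg_mul_of_bil_eq_zero {x y : C.carrier} (hx : C.bil x 1 = 0) (hy : C.bil y 1 = 0)
    (hxy : C.bil x y = 0) : y * x = -(x * y) := by
  have hadd : C.bil (x + y) 1 = 0 := by rw [bil, polar_add_left, ← bil, ← bil, hx, hy, add_zero]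
  have h := mul_self_of_bil_one_eq_zero hadd
  rw [C.norm_add, hxy, add_zero, neg_add, add_smul, ← mul_self_of_bil_one_eq_zero hx,
    ← mul_self_of_bil_one_eq_zero hy, add_mul, mul_add, mul_add] at h
  rw [eq_neg_iff_add_eq_zero, ← sub_eq_zero.mpr h]
  abel

theorem bil_mul_one_eq_zero {x y : C.carrier} (hx : C.bil x 1 = 0) (hxy : C.bil x y = 0) :
    C.bil (x * y) 1 = 0 := by
  rw [C.bil_mul_left_eq, mul_one, conj, hx, zero_smul, zero_sub, bil, polar_neg_right, polar_comm,
    ← bil, hxy, neg_zero]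

end Identities

section Isomorphisms

theorem Iso.symm {C D : CompositionAlgebra k} (h : C.Iso D) : D.Iso C := by
  obtain ⟨f, hf⟩ := h
  exact ⟨f.symm, fun x y => f.injective (by simp [hf])⟩

theorem Iso.trans {C D E : CompositionAlgebra k} (h : C.Iso D) (h' : D.Iso E) : C.Iso E := by
  obtain ⟨f, hf⟩ := h
  obtain ⟨g, hg⟩ := h'
  exact ⟨f.trans g, fun x y => by simp [hf, hg]⟩

variable {C D : CompositionAlgebra k}

theorem injective_of_norm_map {f : D.carrier →ₗ[k] C.carrier}
    (hf : ∀ x, C.norm (f x) = D.norm x) : Function.Injective f := by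
  have hbil (x y : D.carrier) : D.bil x y = C.bil (f x) (f y) := by
    simp only [bil, polar, ← map_add, hf]
  refine (injective_iff_map_eq_zero f).mpr fun x hx => D.ext_bil fun y => ?_
  rw [hbil, hbil, hx, map_zero]

theorem iso_of_norm_map [FiniteDimensional k C.carrier] (f : D.carrier →ₗ[k] C.carrier)
    (hmul : ∀ x y, f (x * y) = f x * f y) (hnorm : ∀ x, C.norm (f x) = D.norm x)
    (hd : Module.finrank k C.carrier ≤ Module.finrank k D.carrier) : C.Iso D := by
  have hf := injective_of_norm_map hnorm
  have : FiniteDimensional k D.carrier := FiniteDimensional.of_injective f hf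
  have hd' := le_antisymm (LinearMap.finrank_le_finrank_of_injective hf) hd
  exact Iso.symm ⟨LinearEquiv.ofInjectiveOfFinrankEq f hf hd', hmul⟩

theorem map_one_of_map_mul {f : C.carrier ≃ₗ[k] D.carrier} (hf : ∀ x y, f (x * y) = f x * f y) :
    f 1 = 1 := by
  simpa using (hf 1 (f.symm 1)).symm

-- For `x` outside `k · 1` the equation `x² = ⟨x, 1⟩ x - N(x)` determines both coefficients.
theorem norm_map_of_map_mul {f : C.carrier ≃ₗ[k] D.carrier} (hf : ∀ x y, f (x * y) = f x * f y)
    (x : C.carrier) : D.norm (f x) = C.norm x := by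
  have h1 := map_one_of_map_mul hf
  have hquad : (D.bil (f x) 1 - C.bil x 1) • f x = (D.norm (f x) - C.norm x) • (1 : D.carrier) := by
    have h := congrArg f (C.mul_self_eq x)
    rw [hf, map_sub, map_smul, map_smul, h1, D.mul_self_eq (f x)] at h
    rw [sub_smul, sub_smul, sub_eq_sub_iff_sub_eq_sub, h]
  obtain ht | ht := eq_or_ne (D.bil (f x) 1 - C.bil x 1) 0
  · rw [ht, zero_smul, eq_comm, smul_eq_zero_iff_left one_ne_zero] at hquad
    exact sub_eq_zero.mp hquad
  · obtain ⟨c, hc⟩ : ∃ c : k, f x = c • (1 : D.carrier) :=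
      ⟨_, by rw [eq_inv_smul_iff₀ ht |>.mpr hquad, smul_smul]⟩
    have hx : x = c • (1 : C.carrier) := f.injective (by rw [hc, map_smul, h1])
    rw [hc, hx, QuadraticMap.map_smul, QuadraticMap.map_smul, C.norm_one, D.norm_one]

theorem Iso.equivalent (h : C.Iso D) : Equivalent C.norm D.norm := by
  obtain ⟨f, hf⟩ := h
  exact ⟨⟨f, norm_map_of_map_mul hf⟩⟩

theorem Iso.finrank_eq (h : C.Iso D) : Module.finrank k C.carrier = Module.finrank k D.carrier := by
  obtain ⟨f, -⟩ := h
  exact f.finrank_eq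

end Isomorphisms

section Generators

variable {C : CompositionAlgebra k}

/-- The linear map from a quadratic algebra determined by the image `u` of its generator. -/
def quadMap (C : CompositionAlgebra k) (a : k) (u : C.carrier) :
    QuadraticAlgebra k a 0 →ₗ[k] C.carrier where
  toFun q := q.re • 1 + q.im • u
  map_add' p q := by simp only [QuadraticAlgebra.re_add, QuadraticAlgebra.im_add]; module
  map_smul' c q := by
    simp only [QuadraticAlgebra.re_smul, QuadraticAlgebra.im_smul, RingHom.id_apply, smul_eq_mul]
    module

theorem quadMap_apply (a : k) (u : C.carrier) (q : QuadraticAlgebra k a 0) :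
    quadMap C a u q = q.re • 1 + q.im • u := rfl

theorem quadMap_mul {u : C.carrier} (hu : C.bil u 1 = 0) {a : k} (ha : C.norm u = -a)
    (p q : QuadraticAlgebra k a 0) :
    quadMap C a u (p * q) = quadMap C a u p * quadMap C a u q := by
  have huu := mul_self_of_bil_one_eq_zero hu
  rw [ha, neg_neg] at huu
  simp only [quadMap_apply, QuadraticAlgebra.re_mul, QuadraticAlgebra.im_mul, add_mul, mul_add,
    smul_mul_assoc, mul_smul_comm, one_mul, mul_one, huu]
  module

theorem norm_quadMap {u : C.carrier} (hu : C.bil u 1 = 0) (a : k) (q : QuadraticAlgebra k a 0) :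
    C.norm (quadMap C a u q) = q.re * q.re + C.norm u * (q.im * q.im) := by
  rw [quadMap_apply, C.norm_add, QuadraticMap.map_smul, QuadraticMap.map_smul, C.norm_one, bil,
    polar_smul_left, polar_smul_right, polar_comm, ← bil, hu]
  simp only [smul_eq_mul]
  ring

/-- The linear map from a quaternion algebra determined by the images `u` and `v` of its
generators. -/
def quatMap (C : CompositionAlgebra k) (a b : k) (u v : C.carrier) :
    QuaternionAlgebra k a 0 b →ₗ[k] C.carrier where
  toFun q := q.re • 1 + q.imI • u + q.imJ • v + q.imK • (u * v)
  map_add' p q := by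
    simp only [QuaternionAlgebra.re_add, QuaternionAlgebra.imI_add, QuaternionAlgebra.imJ_add,
      QuaternionAlgebra.imK_add]
    module
  map_smul' c q := by
    simp only [QuaternionAlgebra.re_smul, QuaternionAlgebra.imI_smul, QuaternionAlgebra.imJ_smul,
      QuaternionAlgebra.imK_smul, RingHom.id_apply, smul_eq_mul]
    module

theorem quatMap_apply (a b : k) (u v : C.carrier) (q : QuaternionAlgebra k a 0 b) :
    quatMap C a b u v q = q.re • 1 + q.imI • u + q.imJ • v + q.imK • (u * v) := rfl

theorem quatMap_mul {u v : C.carrier} (hu : C.bil u 1 = 0) (hv : C.bil v 1 = 0)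
    (huv : C.bil u v = 0) {a b : k} (ha : C.norm u = -a) (hb : C.norm v = -b)
    (p q : QuaternionAlgebra k a 0 b) :
    quatMap C a b u v (p * q) = quatMap C a b u v p * quatMap C a b u v q := by
  have ha' : -C.norm u = a := by rw [ha, neg_neg]
  have hb' : -C.norm v = b := by rw [hb, neg_neg]
  have huu : u * u = a • 1 := by rw [mul_self_of_bil_one_eq_zero hu, ha']
  have hvv : v * v = b • 1 := by rw [mul_self_of_bil_one_eq_zero hv, hb']
  have hvu : v * u = -(u * v) := mul_eq_neg_mul_of_bil_eq_zero hu hv huv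
  have huw : u * (u * v) = a • v := by rw [mul_mul_of_bil_one_eq_zero hu, ha']
  have hwv : u * v * v = b • u := by rw [mul_mul_of_bil_one_eq_zero' hv, hb']
  have hvw : v * (u * v) = -(b • u) := by
    rw [← neg_neg (u * v), ← hvu, mul_neg, mul_mul_of_bil_one_eq_zero hv, hb']
  have hwu : u * v * u = -(a • v) := by
    rw [← neg_neg (u * v), ← hvu, neg_mul, mul_mul_of_bil_one_eq_zero' hu, ha']
  have hww : u * v * (u * v) = -(a * b) • 1 := by
    rw [mul_self_of_bil_one_eq_zero (bil_mul_one_eq_zero hu huv), C.norm_mul, ha, hb, neg_mul_neg]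
  simp only [quatMap_apply, QuaternionAlgebra.re_mul, QuaternionAlgebra.imI_mul,
    QuaternionAlgebra.imJ_mul, QuaternionAlgebra.imK_mul, add_mul, mul_add, smul_mul_assoc,
    mul_smul_comm, one_mul, mul_one, huu, hvv, hvu, huw, hwv, hvw, hwu, hww]
  module

theorem norm_quatMap {u v : C.carrier} (hu : C.bil u 1 = 0) (hv : C.bil v 1 = 0)
    (huv : C.bil u v = 0) (a b : k) (q : QuaternionAlgebra k a 0 b) :
    C.norm (quatMap C a b u v q) = q.re * q.re + C.norm u * (q.imI * q.imI) +
      C.norm v * (q.imJ * q.imJ) + C.norm u * C.norm v * (q.imK * q.imK) := by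
  have huw : C.bil u (u * v) = 0 := by
    simpa [bil, polar_comm _ 1 v, hv] using C.bil_mul_left u 1 v
  have hvw : C.bil v (u * v) = 0 := by
    simpa [bil, polar_comm _ 1 u, hu] using C.bil_mul_right 1 u v
  have hw := bil_mul_one_eq_zero hu huv
  simp only [bil] at hu hv huv huw hvw hw
  simp only [quatMap_apply, C.norm_add, QuadraticMap.map_smul, C.norm_one, C.norm_mul, bil,
    polar_add_left, polar_smul_left, polar_smul_right, polar_comm _ (1 : C.carrier), hu, hv, huv,
    huw, hvw, hw, smul_eq_mul]
  ring

end Generators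

end CompositionAlgebra

theorem nondegenerate_polarBilin_of_equivalent (h2 : (2 : k) ≠ 0) {M ι : Type*} [AddCommGroup M]
    [Module k M] [Fintype ι] {Q : QuadraticForm k M} {w : ι → k} (hw : ∀ i, w i ≠ 0)
    (h : Q.Equivalent (weightedSumSquares k w)) : Q.polarBilin.Nondegenerate := by
  have : NeZero (2 : k) := ⟨h2⟩
  have : Invertible (2 : k) := invertibleOfNonzero h2
  have ⟨f⟩ := h
  have : Module.Finite k M := .equiv f.toLinearEquiv.symm
  rw [nondegenerate_polar_iff, nondegenerate_iff_radical_eq_bot, ← Submodule.finrank_eq_zero,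
    QuadraticForm.finrank_radical_of_equiv_weightedSumSquares h]
  simp [hw]

theorem polar_weightedSumSquares_single {ι : Type*} [Fintype ι] [DecidableEq ι] (w : ι → k)
    (i j : ι) : polar (weightedSumSquares k w) (Pi.single i 1) (Pi.single j 1) =
      2 * diagonal w i j := by
  simp only [polar, weightedSumSquares_apply, ← Finset.sum_sub_distrib, Pi.add_apply, smul_eq_mul,
    diagonal_apply]
  rw [Finset.sum_eq_single i]
  · obtain rfl | hij := eq_or_ne i j
    · simp
      ring
    · simp [hij]
  · intro l _ hl
    simp [hl]
  · simp

/-- The one-dimensional composition algebra `k`. -/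
def alg1 (h2 : (2 : k) ≠ 0) : CompositionAlgebra k where
  carrier := k
  norm := (weightedSumSquares k ![(1 : k)]).comp
    (LinearEquiv.funUnique (Fin 1) k k).symm.toLinearMap
  nondegenerate := nondegenerate_polarBilin_of_equivalent h2 (w := ![1]) (by simp)
    ⟨⟨_, fun _ => rfl⟩⟩
  norm_mul x y := by
    simp [weightedSumSquares_apply]
    ring

/-- The quadratic algebra `k[√a]`, with its norm form `⟨1, -a⟩`. -/
def alg2 (h2 : (2 : k) ≠ 0) {a : k} (ha : a ≠ 0) : CompositionAlgebra k where
  carrier := QuadraticAlgebra k a 0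
  norm := (weightedSumSquares k ![1, -a]).comp
    (QuadraticAlgebra.linearEquivTuple a 0).toLinearMap
  nondegenerate := nondegenerate_polarBilin_of_equivalent h2 (w := ![1, -a])
    (by simp [Fin.forall_fin_succ, ha]) ⟨⟨_, fun _ => rfl⟩⟩
  norm_mul x y := by
    simp [weightedSumSquares_apply]
    ring

/-- The quaternion algebra with norm form `⟨1, a, b, ab⟩`; its generators square to `-a`
and `-b`. -/
def alg4 (h2 : (2 : k) ≠ 0) {a b : k} (ha : a ≠ 0) (hb : b ≠ 0) : CompositionAlgebra k where
  carrier := QuaternionAlgebra k (-a) 0 (-b)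
  norm := (weightedSumSquares k ![1, a, b, a * b]).comp
    (QuaternionAlgebra.linearEquivTuple (-a) 0 (-b)).toLinearMap
  nondegenerate := nondegenerate_polarBilin_of_equivalent h2 (w := ![1, a, b, a * b])
    (by simp [Fin.forall_fin_succ, ha, hb]) ⟨⟨_, fun _ => rfl⟩⟩
  norm_mul x y := by
    simp [weightedSumSquares_apply, Fin.sum_univ_four]
    ring

theorem norm_alg1 (h2 : (2 : k) ≠ 0) (x : k) : (alg1 h2).norm x = x * x :=
  (weightedSumSquares_apply ![(1 : k)] ![x]).trans (by simp)

theorem norm_alg2 (h2 : (2 : k) ≠ 0) {a : k} (ha : a ≠ 0) (q : QuadraticAlgebra k a 0) :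
    (alg2 h2 ha).norm q = q.re * q.re + -a * (q.im * q.im) :=
  (weightedSumSquares_apply ![1, -a] ![q.re, q.im]).trans (by simp)

theorem norm_alg4 (h2 : (2 : k) ≠ 0) {a b : k} (ha : a ≠ 0) (hb : b ≠ 0)
    (q : QuaternionAlgebra k (-a) 0 (-b)) :
    (alg4 h2 ha hb).norm q =
      q.re * q.re + a * (q.imI * q.imI) + b * (q.imJ * q.imJ) + a * b * (q.imK * q.imK) :=
  (weightedSumSquares_apply ![1, a, b, a * b] ![q.re, q.imI, q.imJ, q.imK]).trans
    (by simp [Fin.sum_univ_four])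

theorem rank_alg1 (h2 : (2 : k) ≠ 0) : Module.rank k (alg1 h2).carrier = 1 :=
  Module.rank_self k

theorem rank_alg2 (h2 : (2 : k) ≠ 0) {a : k} (ha : a ≠ 0) :
    Module.rank k (alg2 h2 ha).carrier = 2 :=
  QuadraticAlgebra.rank_eq_two a 0

theorem rank_alg4 (h2 : (2 : k) ≠ 0) {a b : k} (ha : a ≠ 0) (hb : b ≠ 0) :
    Module.rank k (alg4 h2 ha hb).carrier = 4 :=
  QuaternionAlgebra.rank_eq_four (-a) 0 (-b)

namespace CompositionAlgebra

variable {C : CompositionAlgebra k} [FiniteDimensional k C.carrier]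

theorem iso_alg1 (h2 : (2 : k) ≠ 0) (hd : Module.finrank k C.carrier ≤ 1) : C.Iso (alg1 h2) := by
  have hmul (x y : k) : (x * y) • (1 : C.carrier) = x • (1 : C.carrier) * y • (1 : C.carrier) := by
    rw [smul_mul_smul_comm, one_mul]
  have hnorm (x : k) : C.norm (x • 1) = x * x := by
    rw [QuadraticMap.map_smul, C.norm_one, smul_eq_mul, mul_one]
  exact iso_of_norm_map (D := alg1 h2) (LinearMap.toSpanSingleton k C.carrier 1) hmul
    (fun x => (hnorm x).trans (norm_alg1 h2 x).symm)
    (hd.trans (Module.finrank_eq_of_rank_eq (rank_alg1 h2)).ge)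

theorem iso_alg2 (h2 : (2 : k) ≠ 0) {a : k} (ha : a ≠ 0) (hd : Module.finrank k C.carrier ≤ 2)
    {u : C.carrier} (hu : C.bil u 1 = 0) (hNu : C.norm u = -a) : C.Iso (alg2 h2 ha) := by
  refine iso_of_norm_map (D := alg2 h2 ha) (quadMap C a u) (quadMap_mul hu hNu) (fun x => ?_)
    (hd.trans (Module.finrank_eq_of_rank_eq (rank_alg2 h2 ha)).ge)
  refine (norm_quadMap hu a x).trans ?_
  rw [hNu]
  exact (norm_alg2 h2 ha x).symm

theorem iso_alg4 (h2 : (2 : k) ≠ 0) {a b : k} (ha : a ≠ 0) (hb : b ≠ 0)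
    (hd : Module.finrank k C.carrier ≤ 4) {u v : C.carrier} (hu : C.bil u 1 = 0)
    (hv : C.bil v 1 = 0) (huv : C.bil u v = 0) (hNu : C.norm u = a) (hNv : C.norm v = b) :
    C.Iso (alg4 h2 ha hb) := by
  refine iso_of_norm_map (D := alg4 h2 ha hb) (quatMap C (-a) (-b) u v)
    (quatMap_mul hu hv huv (by rw [hNu, neg_neg]) (by rw [hNv, neg_neg])) (fun x => ?_)
    (hd.trans (Module.finrank_eq_of_rank_eq (rank_alg4 h2 ha hb)).ge)
  refine (norm_quatMap hu hv huv _ _ x).trans ?_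
  rw [hNu, hNv]
  exact (norm_alg4 h2 ha hb x).symm

end CompositionAlgebra

namespace CompositionAlgebra

variable {C : CompositionAlgebra k}

/-- A family of pairwise orthogonal pure elements of `C` with norms `w i`. -/
def IsPureFrame {n : ℕ} (u : Fin n → C.carrier) (w : Fin n → k) : Prop :=
  (∀ i, C.bil (u i) 1 = 0) ∧ ∀ i j, C.bil (u i) (u j) = 2 * diagonal w i j

theorem IsPureFrame.norm_eq (h2 : (2 : k) ≠ 0) {n : ℕ} {u : Fin n → C.carrier} {w : Fin n → k}
    (h : IsPureFrame u w) (i : Fin n) : C.norm (u i) = w i := by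
  have hi := h.2 i i
  rw [bil_self, diagonal_apply_eq] at hi
  exact mul_left_cancel₀ h2 hi

theorem IsPureFrame.bil_eq_zero {n : ℕ} {u : Fin n → C.carrier} {w : Fin n → k}
    (h : IsPureFrame u w) {i j : Fin n} (hij : i ≠ j) : C.bil (u i) (u j) = 0 := by
  rw [h.2, diagonal_apply_ne _ hij, mul_zero]

theorem IsPureFrame.bil_sum_smul_one {n : ℕ} {u : Fin n → C.carrier} {w : Fin n → k}
    (h : IsPureFrame u w) (c : Fin n → k) : C.bil (∑ i, c i • u i) 1 = 0 := by
  have hpure (i : Fin n) : C.norm.polarBilin (u i) 1 = 0 := h.1 i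
  rw [bil, ← polarBilin_apply_apply]
  simp only [map_sum, LinearMap.sum_apply, map_smul, LinearMap.smul_apply, hpure, smul_zero,
    Finset.sum_const_zero]

theorem IsPureFrame.bil_sum_smul {n m : ℕ} {u : Fin n → C.carrier} {w : Fin n → k}
    (h : IsPureFrame u w) (G : Matrix (Fin m) (Fin n) k) (i j : Fin m) :
    C.bil (∑ l, G i l • u l) (∑ l, G j l • u l) = 2 * (G * diagonal w * Gᵀ) i j := by
  simp only [← polarBilin_apply_apply, map_sum, LinearMap.sum_apply, map_smul,
    LinearMap.smul_apply, smul_eq_mul]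
  simp only [polarBilin_apply_apply, h.2, mul_apply, transpose_apply,
    Finset.mul_sum, diagonal_apply, mul_ite, mul_zero, Finset.sum_ite_eq', Finset.mem_univ, if_true]
  exact Finset.sum_congr rfl fun l _ => by ring

theorem IsPureFrame.sum_smul {n m : ℕ} {u : Fin n → C.carrier} {w : Fin n → k}
    (h : IsPureFrame u w) {G : Matrix (Fin m) (Fin n) k} {w' : Fin m → k}
    (hG : diagonal w' = G * diagonal w * Gᵀ) : IsPureFrame (fun i => ∑ l, G i l • u l) w' :=
  ⟨fun i => h.bil_sum_smul_one (G i), fun i j => hG ▸ h.bil_sum_smul G i j⟩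

theorem IsPureFrame.exists_eq_mul_mul_transpose (h2 : (2 : k) ≠ 0) {n m : ℕ}
    {u : Fin n → C.carrier} {w : Fin n → k} {v : Fin m → C.carrier} {w' : Fin m → k}
    (hu : IsPureFrame u w) (hspan : ∀ x, ∃ (a : k) (c : Fin n → k), x = a • 1 + ∑ i, c i • u i)
    (hv : IsPureFrame v w') :
    ∃ G : Matrix (Fin m) (Fin n) k, diagonal w' = G * diagonal w * Gᵀ := by
  choose a G hv' using fun i => hspan (v i)
  have ha (i : Fin m) : a i = 0 := by
    have h := hv.1 i
    rw [hv', bil, polar_add_left, ← bil, ← bil, hu.bil_sum_smul_one, bil, polar_smul_left, ← bil,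
      bil_self, C.norm_one] at h
    simpa [h2] using h
  refine ⟨of G, ?_⟩
  ext i j
  refine mul_left_cancel₀ h2 ?_
  rw [← hv.2, ← hu.bil_sum_smul, hv' i, hv' j, ha, ha, zero_smul, zero_add, zero_add]
  rfl

/-- Left multiplication by the conjugate of the first vector of an orthogonal basis moves that
vector to the unit. -/
theorem exists_isPureFrame_of_equivalent {n : ℕ} {w : Fin n → k}
    (h : C.norm.Equivalent (weightedSumSquares k (vecCons 1 w))) :
    ∃ u : Fin n → C.carrier, IsPureFrame u w ∧
      ∀ x, ∃ (a : k) (c : Fin n → k), x = a • 1 + ∑ i, c i • u i := by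
  obtain ⟨f⟩ := h
  let b : Module.Basis (Fin (n + 1)) k C.carrier := .ofEquivFun f.toLinearEquiv
  have hb (i j : Fin (n + 1)) : C.bil (b i) (b j) = 2 * diagonal (vecCons 1 w) i j := by
    rw [← polar_weightedSumSquares_single]
    simp [b, bil, polar, ← f.map_app]
  have hN : C.norm (b 0) = 1 := by
    rw [← f.map_app]
    simp [b, weightedSumSquares_apply, Fin.sum_univ_succ]
  have hb0 : C.conj (b 0) * b 0 = 1 := by
    simpa [hN] using C.conj_mul_mul (b 0) 1
  refine ⟨fun i => C.conj (b 0) * b i.succ, ⟨fun i => ?_, fun i j => ?_⟩, fun x => ?_⟩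
  · rw [← hb0, bil_mul_left, hb, diagonal_apply_ne _ (Fin.succ_ne_zero i), mul_zero, mul_zero]
  · rw [bil_mul_left, norm_conj, hN, one_mul, hb]
    simp [diagonal_apply]
  · refine ⟨b.repr (b 0 * x) 0, fun i => b.repr (b 0 * x) i.succ, ?_⟩
    have hx := C.conj_mul_mul (b 0) x
    rw [hN, one_smul, ← b.sum_repr (b 0 * x), Finset.mul_sum, Fin.sum_univ_succ] at hx
    simpa only [mul_smul_comm, hb0] using hx.symm

theorem eq_zero_of_forall_pure_bil_eq_zero (h2 : (2 : k) ≠ 0) {x : C.carrier} (hx : C.bil x 1 = 0)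
    (h : ∀ y, C.bil y 1 = 0 → C.bil x y = 0) : x = 0 := by
  refine C.ext_bil fun z => ?_
  have hz : C.bil (z - (C.bil z 1 / 2) • 1) 1 = 0 := by
    rw [bil, polar_sub_left, polar_smul_left, ← bil, ← bil, bil_self, C.norm_one, mul_one,
      smul_eq_mul, div_mul_cancel₀ _ h2, sub_self]
  have hxz := h _ hz
  rw [bil, polar_sub_right, polar_smul_right, ← bil, ← bil, hx, smul_zero, sub_zero] at hxz
  rw [hxz, bil, polar_zero_left]

theorem exists_isPureFrame (h2 : (2 : k) ≠ 0) (C : CompositionAlgebra k)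
    [FiniteDimensional k C.carrier] :
    ∃ (n : ℕ) (u : Fin n → C.carrier) (w : Fin n → k),
      n + 1 = Module.finrank k C.carrier ∧ (∀ i, w i ≠ 0) ∧ IsPureFrame u w := by
  have : Invertible (2 : k) := invertibleOfNonzero h2
  let P := LinearMap.ker (C.norm.polarBilin.flip 1)
  have hdim : Module.finrank k P + 1 = Module.finrank k C.carrier := by
    refine Module.Dual.finrank_ker_add_one_of_ne_zero fun h => h2 ?_
    have h1 : C.bil 1 1 = 0 := congr($h 1)
    rwa [bil_self, C.norm_one, mul_one] at h1
  let B : LinearMap.BilinForm k P := C.norm.polarBilin.domRestrict₁₂ P P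
  have hsymm : LinearMap.IsSymm B := ⟨fun x y => polar_comm C.norm x y⟩
  obtain ⟨v, hv⟩ := LinearMap.BilinForm.exists_orthogonal_basis hsymm
  let w (i) : k := C.norm (v i)
  have hB (i j) : B (v i) (v j) = 2 * diagonal w i j := by
    obtain rfl | hij := eq_or_ne i j
    · rw [diagonal_apply_eq]
      exact C.bil_self _
    · rw [diagonal_apply_ne _ hij, mul_zero]
      exact hv hij
  refine ⟨_, fun i => v i, w, hdim, fun i hi => ?_, fun i => (v i).2, hB⟩
  have hBi : B (v i) = 0 := v.ext fun j => by
    rw [hB, diagonal_apply, hi, ite_self, mul_zero, LinearMap.zero_apply]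
  exact v.ne_zero i (Subtype.ext (eq_zero_of_forall_pure_bil_eq_zero h2 (v i).2 fun y hy =>
    congr($hBi ⟨y, hy⟩)))

end CompositionAlgebra

/-! ### Orbits and isomorphism classes -/

open CompositionAlgebra

instance finiteDimensional_carrier (C : SmallCompositionAlgebra k) :
    FiniteDimensional k C.1.carrier :=
  Module.rank_lt_aleph0_iff.mp (C.2.trans_lt (Cardinal.natCast_lt_aleph0 (n := 4)))

namespace NormalForm

/-- The composition algebra attached to `t`, of dimension `1`, `2` or `4`. -/
def alg (h2 : (2 : k) ≠ 0) : NormalForm k → SmallCompositionAlgebra k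
  | one => ⟨alg1 h2, (rank_alg1 h2).trans_le (by norm_num)⟩
  | two _ ha => ⟨alg2 h2 ha, (rank_alg2 h2 ha).trans_le (by norm_num)⟩
  | four _ _ _ ha hb hc => ⟨alg4 h2 (mul_ne_zero hb hc) (mul_ne_zero ha hc), (rank_alg4 h2 _ _).le⟩

theorem finrank_alg (h2 : (2 : k) ≠ 0) (t : NormalForm k) :
    Module.finrank k (t.alg h2).1.carrier = t.pureDim + 1 := by
  cases t with
  | one => exact Module.finrank_eq_of_rank_eq (rank_alg1 h2)
  | two a ha => exact Module.finrank_eq_of_rank_eq (rank_alg2 h2 ha)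
  | four a b c ha hb hc =>
    exact Module.finrank_eq_of_rank_eq (rank_alg4 h2 (mul_ne_zero hb hc) (mul_ne_zero ha hc))

theorem hasNorm_alg (h2 : (2 : k) ≠ 0) (t : NormalForm k) :
    HasNorm (t.alg h2) (vecCons 1 t.pureWeights) := by
  cases t with
  | one => exact ⟨⟨_, fun _ => rfl⟩⟩
  | two a ha => exact ⟨⟨_, fun _ => rfl⟩⟩
  | four a b c ha hb hc =>
    have hscale : Equivalent (weightedSumSquares k ![1, b * c, a * c, b * c * (a * c)])
        (weightedSumSquares k ![1, b * c, a * c, a * b]) :=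
      ⟨QuadraticForm.isometryEquivWeightedSumSquaresWeightedSumSquares
        ![1, 1, 1, Units.mk0 c hc] (by simp [Fin.forall_fin_succ]; ring)⟩
    exact Equivalent.trans ⟨⟨_, fun _ => rfl⟩⟩ hscale

theorem iso_alg_of_isPureFrame (h2 : (2 : k) ≠ 0) (t : NormalForm k) {C : CompositionAlgebra k}
    [FiniteDimensional k C.carrier] (hd : Module.finrank k C.carrier ≤ t.pureDim + 1)
    {u : Fin t.pureDim → C.carrier} (hu : IsPureFrame u t.pureWeights) : C.Iso (t.alg h2).1 := by
  cases t with
  | one => exact iso_alg1 h2 hd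
  | two a ha => exact iso_alg2 h2 ha hd (hu.1 (0 : Fin 1)) (hu.norm_eq h2 (0 : Fin 1))
  | four a b c ha hb hc =>
    exact iso_alg4 h2 (mul_ne_zero hb hc) (mul_ne_zero ha hc) hd (hu.1 (0 : Fin 3))
      (hu.1 (1 : Fin 3)) (hu.bil_eq_zero (Fin.zero_ne_one : (0 : Fin 3) ≠ 1))
      (hu.norm_eq h2 (0 : Fin 3)) (hu.norm_eq h2 (1 : Fin 3))

theorem exists_iso_alg (h2 : (2 : k) ≠ 0) (C : SmallCompositionAlgebra k) :
    ∃ t : NormalForm k, C.1.Iso (t.alg h2).1 := by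
  obtain ⟨n, u, w, hn, hw, hu⟩ := exists_isPureFrame h2 C.1
  match n with
  | 0 => exact ⟨one, iso_alg1 h2 hn.ge⟩
  | 1 => exact ⟨two (-w 0) (neg_ne_zero.mpr (hw 0)),
      iso_alg2 h2 (neg_ne_zero.mpr (hw 0)) hn.ge (hu.1 0) (by rw [hu.norm_eq h2, neg_neg])⟩
  | n + 2 => exact ⟨four (w 1) (w 0) 1 (hw 1) (hw 0) one_ne_zero,
      iso_alg4 h2 (mul_ne_zero (hw 0) one_ne_zero) (mul_ne_zero (hw 1) one_ne_zero)
        (Module.finrank_le_of_rank_le (n := 4) C.2) (hu.1 0) (hu.1 1)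
        (hu.bil_eq_zero Fin.zero_ne_one) (by rw [hu.norm_eq h2, mul_one])
        (by rw [hu.norm_eq h2, mul_one])⟩

theorem hasNorm_iff_iso_alg (h2 : (2 : k) ≠ 0) (t : NormalForm k) (C : SmallCompositionAlgebra k) :
    HasNorm C (vecCons 1 t.pureWeights) ↔ C.1.Iso (t.alg h2).1 := by
  refine ⟨fun h => ?_, fun h => h.equivalent.trans (t.hasNorm_alg h2)⟩
  obtain ⟨u, hu, -⟩ := exists_isPureFrame_of_equivalent h
  obtain ⟨f⟩ := h
  refine t.iso_alg_of_isPureFrame h2 ?_ hu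
  rw [f.toLinearEquiv.finrank_eq, Module.finrank_fin_fun]

theorem alg_iso_alg_iff_congruent (h2 : (2 : k) ≠ 0) {s t : NormalForm k} :
    (s.alg h2).1.Iso (t.alg h2).1 ↔ s.Congruent t := by
  obtain ⟨u, hu, hspan⟩ := exists_isPureFrame_of_equivalent (s.hasNorm_alg h2)
  refine ⟨fun h => ?_, fun ⟨hdim, G, hG⟩ => ?_⟩
  · obtain ⟨v, hv, -⟩ := exists_isPureFrame_of_equivalent ((hasNorm_iff_iso_alg h2 t _).mpr h)
    have hd := h.finrank_eq
    rw [finrank_alg, finrank_alg, Nat.add_right_cancel_iff] at hd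
    exact ⟨hd, hu.exists_eq_mul_mul_transpose h2 hspan hv⟩
  · exact t.iso_alg_of_isPureFrame h2 (by rw [finrank_alg, hdim]) (hu.sum_smul hG)

end NormalForm

theorem exists_equiv_of_surjective {α β γ : Type*} {f : α → β} {g : α → γ}
    (hf : Function.Surjective f) (hg : Function.Surjective g)
    (h : ∀ a b, f a = f b ↔ g a = g b) : ∃ Φ : β ≃ γ, ∀ a, Φ (f a) = g a := by
  have hg_surjInv (a : α) : g (Function.surjInv hf (f a)) = g a :=
    (h _ _).mp (Function.surjInv_eq hf (f a))
  refine ⟨.ofBijective (fun b => g (Function.surjInv hf b)) ⟨fun b c hbc => ?_, fun c => ?_⟩,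
    hg_surjInv⟩
  · rw [← Function.surjInv_eq hf b, ← Function.surjInv_eq hf c]
    exact (h _ _).mpr hbc
  · obtain ⟨a, rfl⟩ := hg c
    exact ⟨f a, hg_surjInv a⟩

theorem isoClass_eq_iff {C D : SmallCompositionAlgebra k} :
    isoClass C = isoClass D ↔ C.1.Iso D.1 :=
  Quotient.eq

namespace NormalForm

/-- The orbit of `t.rep`. -/
def orbit (t : NormalForm k) : nullOrbits k :=
  ⟨spGLOrbit t.rep, t.rep, t.rep_mem_nonzeroNullCone, rfl⟩

theorem coe_orbit (h2 : (2 : k) ≠ 0) (t : NormalForm k) :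
    (t.orbit : Set (Wedge3 k)) = spOrbit t.rep :=
  spGLOrbit_eq_spOrbit h2 t.rep_mem_nonzeroNullCone

theorem rep_mem_orbit_iff (h2 : (2 : k) ≠ 0) (t : NormalForm k) (O : nullOrbits k) :
    t.rep ∈ O.1 ↔ t.orbit = O := by
  obtain ⟨x, hx, hO⟩ := O.2
  rw [Subtype.ext_iff, coe_orbit h2, hO, spGLOrbit_eq_spOrbit h2 hx, spOrbit_eq_iff]

theorem orbit_surjective (h2 : (2 : k) ≠ 0) : Function.Surjective (orbit (k := k)) := by
  intro O
  obtain ⟨x, hx, hO⟩ := O.2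
  obtain ⟨t, ht⟩ := exists_rep_mem_spOrbit h2 hx
  exact ⟨t, (rep_mem_orbit_iff h2 t O).mp (by rwa [hO, spGLOrbit_eq_spOrbit h2 hx])⟩

theorem isoClass_alg_surjective (h2 : (2 : k) ≠ 0) :
    Function.Surjective fun t : NormalForm k => isoClass (t.alg h2) := by
  rintro ⟨C⟩
  obtain ⟨t, ht⟩ := exists_iso_alg h2 C
  exact ⟨t, isoClass_eq_iff.mpr ht.symm⟩

theorem orbit_eq_orbit_iff (h2 : (2 : k) ≠ 0) (s t : NormalForm k) :
    s.orbit = t.orbit ↔ isoClass (s.alg h2) = isoClass (t.alg h2) := by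
  rw [isoClass_eq_iff, alg_iso_alg_iff_congruent, eq_comm, ← rep_mem_orbit_iff h2,
    coe_orbit h2]
  exact ⟨congruent_of_rep_mem_spOrbit h2, rep_mem_spOrbit_of_congruent⟩

theorem exists_nullOrbits_equiv_smallClasses (h2 : (2 : k) ≠ 0) :
    ∃ Φ : nullOrbits k ≃ SmallClasses k, ∀ (O : nullOrbits k) (C : SmallCompositionAlgebra k),
      Φ O = isoClass C →
        ∀ t : NormalForm k, t.rep ∈ O.1 ↔ HasNorm C (Matrix.vecCons 1 t.pureWeights) := by
  obtain ⟨Φ, hΦ⟩ := exists_equiv_of_surjective (orbit_surjective h2)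
    (isoClass_alg_surjective h2) (orbit_eq_orbit_iff h2)
  refine ⟨Φ, fun O C hOC t => ?_⟩
  rw [hasNorm_iff_iso_alg h2, rep_mem_orbit_iff h2, ← Φ.injective.eq_iff, hΦ, hOC, eq_comm,
    isoClass_eq_iff]

end NormalForm

end SixSymplectic

end

theorem theorem5p1 (k : Type*) [Field k] (h2 : (2 : k) ≠ 0) :
    -- the scaling action does not change the orbits
    (∀ x ∈ SixSymplectic.nonzeroNullCone k,
      SixSymplectic.spGLOrbit x = SixSymplectic.spOrbit x) ∧
    -- every nonzero orbit in the null cone contains one of the normal forms, all of which lie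
    -- in the nonzero null cone
    (∀ O ∈ SixSymplectic.nullOrbits k,
      SixSymplectic.rep1 k ∈ O ∨
      (∃ a : k, a ≠ 0 ∧ SixSymplectic.rep2 a ∈ O) ∨
      (∃ a b c : k, a ≠ 0 ∧ b ≠ 0 ∧ c ≠ 0 ∧ SixSymplectic.rep4 a b c ∈ O)) ∧
    SixSymplectic.rep1 k ∈ SixSymplectic.nonzeroNullCone k ∧
    (∀ a : k, a ≠ 0 → SixSymplectic.rep2 a ∈ SixSymplectic.nonzeroNullCone k) ∧
    (∀ a b c : k, a ≠ 0 → b ≠ 0 → c ≠ 0 →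
      SixSymplectic.rep4 a b c ∈ SixSymplectic.nonzeroNullCone k) ∧
    -- the composition algebras of dimension at most four have dimension one, two or four
    (∀ C : SixSymplectic.SmallCompositionAlgebra k,
      Module.finrank k C.1.carrier = 1 ∨ Module.finrank k C.1.carrier = 2 ∨
        Module.finrank k C.1.carrier = 4) ∧
    -- the bijection, with the norm of the algebra attached to each normal form
    ∃ Φ : SixSymplectic.nullOrbits k ≃ SixSymplectic.SmallClasses k,
      ∀ (O : SixSymplectic.nullOrbits k) (C : SixSymplectic.SmallCompositionAlgebra k),
        Φ O = SixSymplectic.isoClass C →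
        (SixSymplectic.rep1 k ∈ O.1 ↔ SixSymplectic.HasNorm C ![(1 : k)]) ∧
        (∀ a : k, a ≠ 0 →
          (SixSymplectic.rep2 a ∈ O.1 ↔ SixSymplectic.HasNorm C ![1, -a])) ∧
        (∀ a b c : k, a ≠ 0 → b ≠ 0 → c ≠ 0 →
          (SixSymplectic.rep4 a b c ∈ O.1 ↔
            SixSymplectic.HasNorm C ![1, b * c, a * c, a * b])) := by
  open SixSymplectic NormalForm in
  refine ⟨fun x hx => spGLOrbit_eq_spOrbit h2 hx, ?_, rep1_mem_nonzeroNullCone,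
    fun a _ => rep2_mem_nonzeroNullCone a, fun a b c ha _ _ => rep4_mem_nonzeroNullCone ha b c,
    fun C => ?_, ?_⟩
  · rintro O ⟨x, hx, rfl⟩
    rw [spGLOrbit_eq_spOrbit h2 hx]
    obtain ⟨t, ht⟩ := exists_rep_mem_spOrbit h2 hx
    cases t with
    | one => exact .inl ht
    | two a ha => exact .inr (.inl ⟨a, ha, ht⟩)
    | four a b c ha hb hc => exact .inr (.inr ⟨a, b, c, ha, hb, hc, ht⟩)
  · obtain ⟨t, ht⟩ := exists_iso_alg h2 C
    rw [ht.finrank_eq, finrank_alg]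
    cases t <;> simp [pureDim]
  · obtain ⟨Φ, hΦ⟩ := exists_nullOrbits_equiv_smallClasses h2
    exact ⟨Φ, fun O C hOC => ⟨hΦ O C hOC one, fun a ha => hΦ O C hOC (two a ha),
      fun a b c ha hb hc => hΦ O C hOC (four a b c ha hb hc)⟩⟩
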